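/- Let $k\ge 1$ be an integer and let $\rho>0$. Let $S^k(\rho)\subset\mathbb{R}^{k+1}$ be the Euclidean sphere of radius $\rho$ centred at the origin, with surface measure $dS_u$. For a point $m\in\mathbb{R}^{k+1}$ with $0<|m|=\eta<\rho$ and for $\alpha\in\mathbb{R}$ put $$F(\alpha)=\int_{S^k(\rho)}\omega(u,m)^{\alpha}\,dS_u,\qquad \omega(u,m)=\frac{|u|^2-|m|^2}{|u-m|^2}.$$ For $\lambda<0$ let $\varphi_\lambda:[0,\infty)\to\mathbb{R}$ be the radial eigenfunction, equal to $1$ at the origin, of the Laplacian of the $(k+1)$-dimensional hyperbolic space of constant sectional curvature $-1/\rho^2$, written in the geodesic distance $r$ from the origin; that is, the unique function that is continuous on $[0,\infty)$, twice differentiable on $(0,\infty)$, and satisfies $$\varphi_\lambda''(r)+\frac{k}{\rho}\coth\Big(\frac r\rho\Big)\varphi_\lambda'(r)+\lambda\,\varphi_\lambda(r)=0\quad(r>0),\qquad \varphi_\lambda(0)=1 .$$ (Such a function exists and is unique for every $\lambda<0$.) Here $f\sim g$ means $f-g=o(g)$. **Theorem.** For every such $m$, as $s\to+\infty$ and also as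 $s\to-\infty$, $$F\Big(\frac k2+s\Big)\sim\left(\frac{\pi\rho(\rho^2-\eta^2)}{\eta|s|}\right)^{k/2}\left(\frac{\rho+\eta}{\rho-\eta}\right)^{|s|}.$$ Equivalently, in terms of the radial eigenfunctions: for every fixed $r>0$, as $\lambda\to-\infty$, $$\varphi_\lambda(r)\sim\left(\frac 2\rho\right)^{k/2}\frac{\Gamma\left(\frac{k+1}{2}\right)}{2\sqrt{\pi}\,\sinh^{k/2}(r/\rho)}\cdot\frac{e^{r\sqrt{-\lambda}}}{(-\lambda)^{k/4}}.$$ -/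

import Mathlib

open MeasureTheory

/-- The surface measure of the Euclidean sphere `S^k(ρ)` of radius `ρ > 0` centred at the origin of
`ℝ^{k+1}`, as a measure on `ℝ^{k+1}`: the image of the surface measure of the unit sphere under
`v ↦ ρ v`, multiplied by `ρ ^ k`. -/
noncomputable def sphereMeasure (k : ℕ) (ρ : ℝ) :
    Measure (EuclideanSpace ℝ (Fin (k + 1))) :=
  ENNReal.ofReal (ρ ^ k) •
    Measure.map
      (fun v : Metric.sphere (0 : EuclideanSpace ℝ (Fin (k + 1))) 1 =>
        ρ • (v : EuclideanSpace ℝ (Fin (k + 1))))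
      (volume : Measure (EuclideanSpace ℝ (Fin (k + 1)))).toSphere

/-- The normalized Poisson kernel `ω(u, m) = (|u|² - |m|²) / |u - m|²`. -/
noncomputable def poissonOmega {k : ℕ} (u m : EuclideanSpace ℝ (Fin (k + 1))) : ℝ :=
  (‖u‖ ^ 2 - ‖m‖ ^ 2) / ‖u - m‖ ^ 2

/-- `F(α) = ∫_{S^k(ρ)} ω(u, m)^α dS_u`, for a point `m` with `|m| < ρ`. -/
noncomputable def sphereIntegral (k : ℕ) (ρ : ℝ) (m : EuclideanSpace ℝ (Fin (k + 1)))
    (α : ℝ) : ℝ :=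
  ∫ u, poissonOmega u m ^ α ∂(sphereMeasure k ρ)

/-- `φ` (a function of the geodesic distance `r ≥ 0` to the origin) is a radial eigenfunction, with
eigenvalue `lam` and with value `1` at the origin, of the Laplacian of the hyperbolic space of
dimension `k + 1` and constant sectional curvature `-1/ρ²`: it solves
`φ'' + (k/ρ) coth(r/ρ) φ' + lam φ = 0` for `r > 0`, is continuous up to `r = 0`, and `φ(0) = 1`. -/
structure IsRadialEigenfunction (k : ℕ) (ρ lam : ℝ) (φ : ℝ → ℝ) : Prop where
  continuousOn : ContinuousOn φ (Set.Ici 0)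
  map_zero : φ 0 = 1
  differentiableAt : ∀ r, 0 < r → DifferentiableAt ℝ φ r
  differentiableAt_deriv : ∀ r, 0 < r → DifferentiableAt ℝ (deriv φ) r
  ode : ∀ r, 0 < r →
    deriv (deriv φ) r + (k / ρ) * (Real.cosh (r / ρ) / Real.sinh (r / ρ)) * deriv φ r
      + lam * φ r = 0

/-! Put `x = log((ρ+η)/(ρ-η))`, let `θ` be the angle between `u` and `m`, and write `D = cosh x -
sinh x cos θ`. Then `ω(u, m) = 1/D`, so slicing the sphere by `θ` turns `F(α)` into `ρ^k |S^(k-1)|`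
times `L_α(x) = ∫_0^π D^(-α) sin^(k-1) θ dθ` (`sphereIntegral_eq_legendreIntegral`).

As `s → +∞` with `α = k/2 + s`, the mass of `L_α` concentrates at `θ = 0`, where `D` attains its
minimum `e^(-x)`. Laplace's method on the scale `θ = v/√α` gives a Gaussian integral
(`tendsto_rpow_mul_legendreIntegral`).

Differentiation under the integral shows that `L_α(r/ρ)/L_α(0)` is a radial eigenfunction with `λρ²
= -α(α-k)` (`isRadialEigenfunction_legendreIntegral`). A Wronskian argument gives uniqueness
(`IsRadialEigenfunction.eqOn`). Since `α` and `k - α` share an eigenvalue, `L_α = L_(k-α)`, which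
reduces `s → -∞` to `s → +∞`. Uniqueness also identifies `φ_λ` with the normalized `L_α` for `α =
k/2 + √(k²/4 - λρ²)`, so the same Laplace asymptotics give the second form. -/

/-! ### Polar coordinates and integration over the sphere of a function of one coordinate -/

open Set in
theorem lintegral_eq_lintegral_toSphere_lintegral_Ioi {E : Type*} [NormedAddCommGroup E]
    [NormedSpace ℝ E] [MeasurableSpace E] [BorelSpace E] [FiniteDimensional ℝ E] [Nontrivial E]
    (μ : Measure E) [μ.IsAddHaarMeasure] {g : E → ENNReal} (hg : Measurable g) :
    ∫⁻ x, g x ∂μ = ∫⁻ u : Metric.sphere (0 : E) 1, (∫⁻ r in Ioi (0 : ℝ),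
      ENNReal.ofReal (r ^ (Module.finrank ℝ E - 1)) * g (r • (u : E))) ∂μ.toSphere := by
  have hg' : Measurable fun p : Metric.sphere (0 : E) 1 × Ioi (0 : ℝ) =>
      g ((p.2 : ℝ) • (p.1 : E)) := by
    apply hg.comp
    apply Measurable.smul
    · exact measurable_subtype_coe.comp measurable_snd
    · exact measurable_subtype_coe.comp measurable_fst
  calc
    ∫⁻ x, g x ∂μ = ∫⁻ x : ({(0)}ᶜ : Set E), g x.1 ∂(μ.comap (↑)) := by
      rw [lintegral_subtype_comap (measurableSet_singleton _).compl g,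
        restrict_compl_singleton]
    _ = ∫⁻ p : Metric.sphere (0 : E) 1 × Ioi (0 : ℝ), g ((p.2 : ℝ) • (p.1 : E))
          ∂μ.toSphere.prod (.volumeIoiPow (Module.finrank ℝ E - 1)) := by
      rw [← μ.measurePreserving_homeomorphUnitSphereProd.lintegral_comp_emb
        (Homeomorph.measurableEmbedding _)]
      refine lintegral_congr fun x => ?_
      have hx : ‖(x : E)‖ ≠ 0 := norm_ne_zero_iff.2 x.2
      simp [smul_smul, hx]
    _ = ∫⁻ u : Metric.sphere (0 : E) 1, ∫⁻ r : Ioi (0 : ℝ), g ((r : ℝ) • (u : E))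
          ∂(Measure.volumeIoiPow (Module.finrank ℝ E - 1)) ∂μ.toSphere :=
      lintegral_prod _ hg'.aemeasurable
    _ = _ := by
      refine lintegral_congr fun u => ?_
      have hm : Measurable fun r : Ioi (0 : ℝ) => g ((r : ℝ) • (u : E)) := hg.comp (by fun_prop)
      rw [Measure.volumeIoiPow, lintegral_withDensity_eq_lintegral_mul _ (by fun_prop) hm]
      exact lintegral_subtype_comap measurableSet_Ioi
        (fun r : ℝ => ENNReal.ofReal (r ^ (Module.finrank ℝ E - 1)) * g (r • (u : E)))

open Set in
theorem lintegral_comp_norm {E : Type*} [NormedAddCommGroup E]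
    [NormedSpace ℝ E] [MeasurableSpace E] [BorelSpace E] [FiniteDimensional ℝ E] [Nontrivial E]
    (μ : Measure E) [μ.IsAddHaarMeasure] {h : ℝ → ENNReal} (hh : Measurable h) :
    ∫⁻ x, h ‖x‖ ∂μ = μ.toSphere univ * ∫⁻ r in Ioi (0 : ℝ),
      ENNReal.ofReal (r ^ (Module.finrank ℝ E - 1)) * h r := by
  rw [lintegral_eq_lintegral_toSphere_lintegral_Ioi μ (g := fun x => h ‖x‖)
    (hh.comp measurable_norm)]
  rw [mul_comm, ← lintegral_const]
  refine lintegral_congr fun u => setLIntegral_congr_fun measurableSet_Ioi fun r hr => ?_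
  have hr' : (0 : ℝ) < r := hr
  simp [norm_smul, abs_of_pos hr']

/-- Integration over `ℝ^(k+1)`, with one coordinate split off. -/
theorem lintegral_euclideanSpace_succ (k : ℕ)
    {g : ℝ → ℝ → ENNReal} (hg : Measurable (Function.uncurry g)) :
    ∫⁻ x : EuclideanSpace ℝ (Fin (k + 1)), g (x 0) ‖x‖ =
      ∫⁻ t : ℝ, ∫⁻ y : EuclideanSpace ℝ (Fin k), g t (Real.sqrt (t ^ 2 + ‖y‖ ^ 2)) := by
  have hnorm : ∀ x : EuclideanSpace ℝ (Fin (k + 1)), ‖x‖ =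
      Real.sqrt ((x 0) ^ 2 + ‖WithLp.toLp 2 (fun i : Fin k => x i.succ)‖ ^ 2) := by
    intro x
    rw [EuclideanSpace.norm_sq_eq, EuclideanSpace.norm_eq, Fin.sum_univ_succ]
    simp
  let G : ℝ × (Fin k → ℝ) → ENNReal := fun p =>
    g p.1 (Real.sqrt (p.1 ^ 2 + ‖WithLp.toLp 2 p.2‖ ^ 2))
  have hG : Measurable G := by
    refine hg.comp (Measurable.prodMk measurable_fst ?_)
    have : Measurable fun p : ℝ × (Fin k → ℝ) => ‖WithLp.toLp 2 p.2‖ :=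
      (((PiLp.continuous_toLp 2 (fun _ : Fin k => ℝ)).comp continuous_snd).norm).measurable
    fun_prop
  calc ∫⁻ x : EuclideanSpace ℝ (Fin (k + 1)), g (x 0) ‖x‖
      = ∫⁻ x : EuclideanSpace ℝ (Fin (k + 1)),
          G (MeasurableEquiv.piFinSuccAbove (fun _ : Fin (k + 1) => ℝ) 0 (WithLp.ofLp x)) := by
        refine lintegral_congr fun x => ?_
        rw [hnorm x]
        rfl
    _ = ∫⁻ z : Fin (k + 1) → ℝ, G (MeasurableEquiv.piFinSuccAbove (fun _ : Fin (k + 1) => ℝ) 0 z) :=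
        (PiLp.volume_preserving_ofLp (Fin (k + 1))).lintegral_comp
          (hG.comp (MeasurableEquiv.measurable _))
    _ = ∫⁻ p : ℝ × (Fin k → ℝ), G p :=
        (volume_preserving_piFinSuccAbove (fun _ : Fin (k + 1) => ℝ) 0).lintegral_comp hG
    _ = ∫⁻ t : ℝ, ∫⁻ y : Fin k → ℝ, G (t, y) := lintegral_prod _ hG.aemeasurable
    _ = _ := by
        refine lintegral_congr fun t => ?_
        have : Measurable fun y : Fin k → ℝ => G (t, y) := hG.comp (by fun_prop)
        rw [← (PiLp.volume_preserving_ofLp (Fin k)).lintegral_comp this]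

open Set in
/-- Polar coordinates in the upper half-plane. -/
theorem lintegral_upperHalfPlane_polar {h : ℝ → ℝ → ENNReal}
    (hh : Measurable (Function.uncurry h)) (n : ℕ) :
    ∫⁻ t : ℝ, ∫⁻ s in Ioi (0 : ℝ), ENNReal.ofReal (s ^ n) * h t (Real.sqrt (t ^ 2 + s ^ 2)) =
      ∫⁻ θ in Ioo (0 : ℝ) Real.pi, ∫⁻ r in Ioi (0 : ℝ),
        ENNReal.ofReal (r * (r * Real.sin θ) ^ n) * h (r * Real.cos θ) r := by
  -- Extending by zero to the lower half-plane makes full planar polar coordinates applicable; the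
  -- angles in `(-π, 0]` then contribute nothing.
  let H : ℝ × ℝ → ENNReal := fun p => (Ioi (0 : ℝ)).indicator
    (fun s => ENNReal.ofReal (s ^ n) * h p.1 (Real.sqrt (p.1 ^ 2 + s ^ 2))) p.2
  have hH : Measurable H := by
    have h1 : Measurable fun p : ℝ × ℝ =>
        ENNReal.ofReal (p.2 ^ n) * h p.1 (Real.sqrt (p.1 ^ 2 + p.2 ^ 2)) := by
      apply Measurable.mul (by fun_prop)
      have h2 : Measurable fun p : ℝ × ℝ => (p.1, Real.sqrt (p.1 ^ 2 + p.2 ^ 2)) := by fun_prop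
      exact hh.comp h2
    exact h1.indicator (measurable_snd measurableSet_Ioi)
  have hHm : Measurable fun p : ℝ × ℝ => ENNReal.ofReal p.1 *
      H (p.1 * Real.cos p.2, p.1 * Real.sin p.2) :=
    Measurable.mul (by fun_prop) (hH.comp (by fun_prop))
  calc _ = ∫⁻ t : ℝ, ∫⁻ s : ℝ, H (t, s) := by
        refine lintegral_congr fun t => ?_
        rw [← lintegral_indicator measurableSet_Ioi]
    _ = ∫⁻ p : ℝ × ℝ, H p := (lintegral_prod _ hH.aemeasurable).symm
    _ = ∫⁻ p in polarCoord.target, ENNReal.ofReal p.1 • H (polarCoord.symm p) :=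
        (lintegral_comp_polarCoord_symm H).symm
    _ = ∫⁻ p in polarCoord.target, ENNReal.ofReal p.1 *
          H (p.1 * Real.cos p.2, p.1 * Real.sin p.2) := by
        simp only [polarCoord_symm_apply, smul_eq_mul]
    _ = ∫⁻ θ in Ioo (-Real.pi) Real.pi, ∫⁻ r in Ioi (0 : ℝ), ENNReal.ofReal r *
          H (r * Real.cos θ, r * Real.sin θ) := by
        rw [polarCoord_target, Measure.volume_eq_prod, ← Measure.prod_restrict,
          lintegral_prod_symm _ hHm.aemeasurable]
    _ = ∫⁻ θ in Ioo (-Real.pi) Real.pi, (Ioo (0 : ℝ) Real.pi).indicator (fun θ =>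
          ∫⁻ r in Ioi (0 : ℝ), ENNReal.ofReal (r * (r * Real.sin θ) ^ n) *
            h (r * Real.cos θ) r) θ := by
        refine setLIntegral_congr_fun measurableSet_Ioo fun θ hθ => ?_
        by_cases h0 : 0 < θ
        · rw [indicator_of_mem (show θ ∈ Ioo (0 : ℝ) Real.pi from ⟨h0, hθ.2⟩)]
          refine setLIntegral_congr_fun measurableSet_Ioi fun r hr => ?_
          have hr' : (0 : ℝ) < r := hr
          have hs : 0 < Real.sin θ := Real.sin_pos_of_pos_of_lt_pi h0 hθ.2
          have hrs : r * Real.sin θ ∈ Ioi (0 : ℝ) := mul_pos hr' hs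
          have hsq : Real.sqrt ((r * Real.cos θ) ^ 2 + (r * Real.sin θ) ^ 2) = r := by
            rw [show (r * Real.cos θ) ^ 2 + (r * Real.sin θ) ^ 2
              = r ^ 2 * (Real.sin θ ^ 2 + Real.cos θ ^ 2) by ring, Real.sin_sq_add_cos_sq, mul_one,
              Real.sqrt_sq hr'.le]
          simp only [H, indicator_of_mem hrs, hsq]
          rw [← mul_assoc, ← ENNReal.ofReal_mul hr'.le]
        · rw [indicator_of_notMem (fun h => h0 h.1)]
          rw [lintegral_eq_zero_iff' ?_]
          · filter_upwards [ae_restrict_mem measurableSet_Ioi] with r hr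
            have hs : Real.sin θ ≤ 0 := Real.sin_nonpos_of_nonpos_of_neg_pi_le (not_lt.1 h0) hθ.1.le
            have : r * Real.sin θ ∉ Ioi (0 : ℝ) := not_lt.2 (mul_nonpos_of_nonneg_of_nonpos
              (le_of_lt hr) hs)
            simp only [H, indicator_of_notMem this]
            simp
          · apply Measurable.aemeasurable
            apply Measurable.mul (by fun_prop)
            exact hH.comp (by fun_prop)
    _ = _ := by
        rw [lintegral_indicator measurableSet_Ioo, Measure.restrict_restrict measurableSet_Ioo,
          Ioo_inter_Ioo]
        simp [Real.pi_pos.le]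

open Set in
/-- Integration over the unit sphere of a function of one coordinate. -/
theorem lintegral_toSphere_inner (k : ℕ) (hk : 1 ≤ k) (e : EuclideanSpace ℝ (Fin (k + 1)))
    (he : ‖e‖ = 1) {f : ℝ → ENNReal} (hf : Measurable f) :
    ∫⁻ u : Metric.sphere (0 : EuclideanSpace ℝ (Fin (k + 1))) 1, f (inner ℝ e (u : _))
        ∂(volume : Measure (EuclideanSpace ℝ (Fin (k + 1)))).toSphere =
      (volume : Measure (EuclideanSpace ℝ (Fin k))).toSphere univ *
        ∫⁻ θ in Ioo (0 : ℝ) Real.pi, ENNReal.ofReal (Real.sin θ ^ (k - 1)) * f (Real.cos θ) := by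
  have : Nonempty (Fin k) := ⟨⟨0, hk⟩⟩
  -- An isometry carries `e` to the first coordinate vector.
  obtain ⟨b, hb⟩ : ∃ b : OrthonormalBasis (Fin (k + 1)) ℝ (EuclideanSpace ℝ (Fin (k + 1))),
      b 0 = e := by
    have ho : Orthonormal ℝ (({0} : Set (Fin (k + 1))).domRestrict fun _ => e) := by
      constructor
      · intro i; exact he
      · intro i j hij; exact absurd (Subsingleton.elim i j) hij
    obtain ⟨b, hb⟩ := ho.exists_orthonormalBasis_extension_of_card_eq (by simp)
    exact ⟨b, hb 0 rfl⟩
  -- The integral of `f(⟨e, x⟩/|x|)` over the unit ball is computed in two ways. Both results carry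
  -- the radial factor `G = ∫_0^1 r^k dr`, which is finite and nonzero and hence cancels.
  let W : ℝ → ENNReal := (Iio (1 : ℝ)).indicator fun _ => 1
  have hW : Measurable W := measurable_const.indicator measurableSet_Iio
  let G : ENNReal := ∫⁻ r in Ioi (0 : ℝ), ENNReal.ofReal (r ^ k) * W r
  have hGeq : G = ∫⁻ r in Ioo (0 : ℝ) 1, ENNReal.ofReal (r ^ k) := by
    have : (Ioo (0 : ℝ) 1) = Iio 1 ∩ Ioi 0 := by ext; simp [and_comm]
    rw [this, ← Measure.restrict_restrict measurableSet_Iio, ← lintegral_indicator measurableSet_Iio]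
    refine lintegral_congr fun r => ?_
    by_cases hr : r ∈ Iio (1 : ℝ) <;> simp only [W, hr, indicator_of_mem, indicator_of_notMem,
      mul_one, mul_zero, not_false_eq_true]
  have hGtop : G ≠ ⊤ := by
    rw [hGeq]
    refine ne_top_of_le_ne_top (b := ∫⁻ r in Ioo (0 : ℝ) 1, 1) (by simp) ?_
    refine setLIntegral_mono measurable_const fun r hr => ?_
    exact ENNReal.ofReal_le_one.2 (pow_le_one₀ hr.1.le hr.2.le)
  have hG0 : G ≠ 0 := by
    rw [hGeq]
    apply ne_of_gt
    rw [setLIntegral_pos_iff (by fun_prop)]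
    refine lt_of_lt_of_le (b := volume (Ioo (0 : ℝ) 1)) (by simp) (measure_mono fun r hr => ?_)
    refine ⟨?_, hr⟩
    simpa using pow_pos hr.1 k
  have key1 : ∫⁻ x : EuclideanSpace ℝ (Fin (k + 1)), f (inner ℝ e x / ‖x‖) * W ‖x‖ =
      (∫⁻ u : Metric.sphere (0 : EuclideanSpace ℝ (Fin (k + 1))) 1, f (inner ℝ e (u : _))
        ∂(volume : Measure (EuclideanSpace ℝ (Fin (k + 1)))).toSphere) * G := by
    rw [lintegral_eq_lintegral_toSphere_lintegral_Ioi volume]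
    · rw [← lintegral_mul_const' _ _ hGtop]
      refine lintegral_congr fun u => ?_
      rw [← lintegral_const_mul _ (by fun_prop)]
      refine setLIntegral_congr_fun measurableSet_Ioi fun r hr => ?_
      have hr' : (0 : ℝ) < r := hr
      simp only [norm_smul, norm_eq_of_mem_sphere, mul_one, Real.norm_eq_abs, abs_of_pos hr',
        inner_smul_right, finrank_euclideanSpace, Fintype.card_fin, Nat.add_sub_cancel]
      rw [mul_div_cancel_left₀ _ hr'.ne']
      ring
    · apply Measurable.mul
      · exact hf.comp (Measurable.div (by fun_prop) (by fun_prop))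
      · exact hW.comp (by fun_prop)
  have key2 : ∫⁻ x : EuclideanSpace ℝ (Fin (k + 1)), f (inner ℝ e x / ‖x‖) * W ‖x‖ =
      ∫⁻ x : EuclideanSpace ℝ (Fin (k + 1)), f (x 0 / ‖x‖) * W ‖x‖ := by
    rw [← (b.measurePreserving_repr).lintegral_comp (f := fun x => f (x 0 / ‖x‖) * W ‖x‖)]
    · refine lintegral_congr fun x => ?_
      rw [b.repr_apply_apply, hb, LinearIsometryEquiv.norm_map]
    · apply Measurable.mul
      · exact hf.comp (Measurable.div (by fun_prop) (by fun_prop))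
      · exact hW.comp (by fun_prop)
  have hg : Measurable (Function.uncurry fun t R : ℝ => f (t / R) * W R) := by
    apply Measurable.mul
    · exact hf.comp (Measurable.div (by fun_prop) (by fun_prop))
    · exact hW.comp (by fun_prop)
  -- The integrand is radial in the last `k` coordinates. They yield the area of `S^(k-1)` and the
  -- weight `s^(k-1)`, and leave a half-plane integral.
  have key3 : ∫⁻ x : EuclideanSpace ℝ (Fin (k + 1)), f (x 0 / ‖x‖) * W ‖x‖ =
      (volume : Measure (EuclideanSpace ℝ (Fin k))).toSphere univ *
        ∫⁻ θ in Ioo (0 : ℝ) Real.pi, ∫⁻ r in Ioi (0 : ℝ),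
        ENNReal.ofReal (r * (r * Real.sin θ) ^ (k - 1)) * (f (r * Real.cos θ / r) * W r) := by
    rw [lintegral_euclideanSpace_succ k hg, ← lintegral_upperHalfPlane_polar hg (k - 1),
      ← lintegral_const_mul' _ _ (measure_ne_top _ _)]
    refine lintegral_congr fun t => ?_
    have hm : Measurable fun s : ℝ => f (t / Real.sqrt (t ^ 2 + s ^ 2)) *
        W (Real.sqrt (t ^ 2 + s ^ 2)) := by
      apply Measurable.mul
      · exact hf.comp (Measurable.div (by fun_prop) (by fun_prop))
      · exact hW.comp (by fun_prop)
    have := lintegral_comp_norm (volume : Measure (EuclideanSpace ℝ (Fin k))) hm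
    rw [finrank_euclideanSpace, Fintype.card_fin] at this
    exact this
  have key4 : ∫⁻ θ in Ioo (0 : ℝ) Real.pi, ∫⁻ r in Ioi (0 : ℝ),
        ENNReal.ofReal (r * (r * Real.sin θ) ^ (k - 1)) * (f (r * Real.cos θ / r) * W r) =
      (∫⁻ θ in Ioo (0 : ℝ) Real.pi, ENNReal.ofReal (Real.sin θ ^ (k - 1)) * f (Real.cos θ)) * G := by
    rw [← lintegral_mul_const' _ _ hGtop]
    refine setLIntegral_congr_fun measurableSet_Ioo fun θ hθ => ?_
    rw [← lintegral_const_mul _ (by fun_prop)]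
    refine setLIntegral_congr_fun measurableSet_Ioi fun r hr => ?_
    have hr' : (0 : ℝ) < r := hr
    have hs : 0 < Real.sin θ := Real.sin_pos_of_pos_of_lt_pi hθ.1 hθ.2
    have : r * (r * Real.sin θ) ^ (k - 1) = Real.sin θ ^ (k - 1) * r ^ k := by
      obtain ⟨n, rfl⟩ : ∃ n, k = n + 1 := ⟨k - 1, by omega⟩
      simp; ring
    rw [this, mul_div_cancel_left₀ _ hr'.ne', ENNReal.ofReal_mul (by positivity)]
    ring
  rw [key4, ← key2, key1, ← mul_assoc] at key3
  exact (ENNReal.mul_left_inj hG0 hGtop).1 key3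

/-! ### Reduction of the sphere integral to a Legendre integral -/

/-- The integral `∫_0^π (cosh x - sinh x cos θ)^(-α) (sin θ)^(k-1) dθ`, a multiple of an associated
Legendre function. -/
noncomputable def legendreIntegral (k : ℕ) (α x : ℝ) : ℝ :=
  ∫ θ in (0 : ℝ)..Real.pi, (Real.cosh x - Real.sinh x * Real.cos θ) ^ (-α) * Real.sin θ ^ (k - 1)

theorem exp_neg_abs_le_cosh_sub_sinh_mul (x : ℝ) {t : ℝ} (ht : |t| ≤ 1) :
    Real.exp (-|x|) ≤ Real.cosh x - Real.sinh x * t := by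
  rw [← Real.cosh_sub_sinh |x|, Real.cosh_abs, ← Real.abs_sinh]
  have := abs_mul (Real.sinh x) t
  have h2 : |Real.sinh x| * |t| ≤ |Real.sinh x| := mul_le_of_le_one_right (abs_nonneg _) ht
  linarith [le_abs_self (Real.sinh x * t)]

theorem cosh_sub_sinh_mul_pos (x : ℝ) {t : ℝ} (ht : |t| ≤ 1) :
    0 < Real.cosh x - Real.sinh x * t :=
  (Real.exp_pos _).trans_le (exp_neg_abs_le_cosh_sub_sinh_mul x ht)

/-- In the ball model of radius `ρ`, this logarithm is the hyperbolic distance from the origin to a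
point of Euclidean norm `η`, divided by `ρ`. -/
theorem cosh_sinh_log_div {ρ η : ℝ} (h0 : 0 < η) (h1 : η < ρ) :
    Real.cosh (Real.log ((ρ + η) / (ρ - η))) = (ρ ^ 2 + η ^ 2) / (ρ ^ 2 - η ^ 2) ∧
    Real.sinh (Real.log ((ρ + η) / (ρ - η))) = 2 * ρ * η / (ρ ^ 2 - η ^ 2) := by
  have h2 : 0 < ρ - η := by linarith
  have h3 : 0 < ρ + η := by linarith
  have h4 : ρ ^ 2 - η ^ 2 = (ρ - η) * (ρ + η) := by ring
  rw [Real.cosh_log (by positivity), Real.sinh_log (by positivity), h4]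
  constructor <;> field_simp <;> ring

open Set in
-- For nonnegative integrands both sides are `toReal` of a `lintegral`, so integrability plays no
-- role. The sign is required only on `[-1, 1]`, because the base of the power to be integrated can
-- be negative elsewhere.
theorem integral_toSphere_inner (k : ℕ) (hk : 1 ≤ k) (e : EuclideanSpace ℝ (Fin (k + 1)))
    (he : ‖e‖ = 1) {f : ℝ → ℝ} (hf : Measurable f) (hf0 : ∀ t, |t| ≤ 1 → 0 ≤ f t) :
    ∫ u : Metric.sphere (0 : EuclideanSpace ℝ (Fin (k + 1))) 1, f (inner ℝ e (u : _))
        ∂(volume : Measure (EuclideanSpace ℝ (Fin (k + 1)))).toSphere =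
      (volume : Measure (EuclideanSpace ℝ (Fin k))).toSphere.real univ *
        ∫ θ in (0 : ℝ)..Real.pi, f (Real.cos θ) * Real.sin θ ^ (k - 1) := by
  rw [intervalIntegral.integral_of_le Real.pi_pos.le, integral_Ioc_eq_integral_Ioo,
    integral_eq_lintegral_of_nonneg_ae, integral_eq_lintegral_of_nonneg_ae, Measure.real,
    ← ENNReal.toReal_mul, lintegral_toSphere_inner k hk e he hf.ennreal_ofReal]
  · congr 2
    refine setLIntegral_congr_fun measurableSet_Ioo fun θ hθ => ?_
    have hs : 0 < Real.sin θ := Real.sin_pos_of_pos_of_lt_pi hθ.1 hθ.2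
    rw [← ENNReal.ofReal_mul (by positivity), mul_comm]
  · filter_upwards [ae_restrict_mem measurableSet_Ioo] with θ hθ
    have hs : 0 < Real.sin θ := Real.sin_pos_of_pos_of_lt_pi hθ.1 hθ.2
    exact mul_nonneg (hf0 _ (Real.abs_cos_le_one _)) (by positivity)
  · exact (Measurable.mul (hf.comp Real.measurable_cos) (by fun_prop)).aestronglyMeasurable
  · refine Filter.Eventually.of_forall fun u => hf0 _ ?_
    have := abs_real_inner_le_norm e (u : EuclideanSpace ℝ (Fin (k + 1)))
    simpa [he] using this
  · exact (hf.comp (by fun_prop)).aestronglyMeasurable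

/-- With `t` the cosine of the angle, `|u - m|² = ρ² + η² - 2ρηt`. Division by `ρ² - η²` gives `1/ω
= cosh x - sinh x · t`, a function of one coordinate. -/
theorem sphereIntegral_eq_legendreIntegral {k : ℕ} (hk : 1 ≤ k) {ρ η : ℝ}
    {m : EuclideanSpace ℝ (Fin (k + 1))} (hm : ‖m‖ = η) (h0 : 0 < η) (h1 : η < ρ) (α : ℝ) :
    sphereIntegral k ρ m α = ρ ^ k * ((volume : Measure (EuclideanSpace ℝ (Fin k))).toSphere.real
      Set.univ * legendreIntegral k α (Real.log ((ρ + η) / (ρ - η)))) := by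
  have hρ : 0 < ρ := h0.trans h1
  have he : ‖η⁻¹ • m‖ = 1 := by
    rw [norm_smul, hm, Real.norm_eq_abs, abs_of_pos (by positivity)]
    field_simp
  obtain ⟨hc, hs⟩ := cosh_sinh_log_div h0 h1
  set x := Real.log ((ρ + η) / (ρ - η))
  let f : ℝ → ℝ := fun t => (Real.cosh x - Real.sinh x * t) ^ (-α)
  have hf : Measurable f := by fun_prop
  have key := integral_toSphere_inner k hk (η⁻¹ • m) he hf
    (fun t ht => Real.rpow_nonneg (cosh_sub_sinh_mul_pos x ht).le _)
  rw [legendreIntegral, ← key, sphereIntegral, sphereMeasure, integral_smul_measure,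
    ENNReal.toReal_ofReal (by positivity), smul_eq_mul, integral_map]
  · congr 1
    refine integral_congr_ae (Filter.Eventually.of_forall fun u => ?_)
    have hu : ‖(u : EuclideanSpace ℝ (Fin (k + 1)))‖ = 1 := norm_eq_of_mem_sphere u
    have ht : |inner ℝ (η⁻¹ • m) (u : EuclideanSpace ℝ (Fin (k + 1)))| ≤ 1 := by
      simpa [he, hu] using abs_real_inner_le_norm (η⁻¹ • m) (u : EuclideanSpace ℝ (Fin (k + 1)))
    have hpos := cosh_sub_sinh_mul_pos x ht
    have hη : inner ℝ (u : EuclideanSpace ℝ (Fin (k + 1))) m =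
        η * inner ℝ (η⁻¹ • m) (u : EuclideanSpace ℝ (Fin (k + 1))) := by
      rw [real_inner_smul_left, real_inner_comm]; field_simp
    simp only [f]
    rw [Real.rpow_neg hpos.le, ← Real.inv_rpow hpos.le]
    congr 1
    rw [poissonOmega, norm_sub_sq_real, real_inner_smul_left, hη, norm_smul, hu, hm, mul_one,
      Real.norm_eq_abs, sq_abs, hc, hs]
    set t := inner ℝ (η⁻¹ • m) (u : EuclideanSpace ℝ (Fin (k + 1)))
    have h4 : 0 < ρ ^ 2 - η ^ 2 := by nlinarith
    rw [← inv_inj, inv_inv, inv_div]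
    field_simp
    ring
  · fun_prop
  · apply Measurable.aestronglyMeasurable
    unfold poissonOmega
    fun_prop

/-! ### The differential equation of the Legendre integral -/

/-- The dominating function is a constant: a bound of `F'` on the compact rectangle `[x₀ - 1, x₀ +
1] × [a, b]`. -/
theorem hasDerivAt_intervalIntegral_of_continuous {F F' : ℝ → ℝ → ℝ}
    (hF : ∀ x, Continuous (F x)) (hF' : Continuous (Function.uncurry F'))
    (h : ∀ x t, HasDerivAt (fun y => F y t) (F' x t) x) (a b x₀ : ℝ) :
    HasDerivAt (fun x => ∫ t in a..b, F x t) (∫ t in a..b, F' x₀ t) x₀ := by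
  obtain ⟨C, hC⟩ := ((isCompact_Icc (a := x₀ - 1) (b := x₀ + 1)).prod
    (isCompact_uIcc (a := a) (b := b))).exists_bound_of_continuousOn hF'.continuousOn
  refine (intervalIntegral.hasDerivAt_integral_of_dominated_loc_of_deriv_le (F' := F')
    (bound := fun _ => C) (Icc_mem_nhds (by linarith) (by linarith) :
      Set.Icc (x₀ - 1) (x₀ + 1) ∈ nhds x₀)
    (Filter.Eventually.of_forall fun x => (hF x).aestronglyMeasurable)
    ((hF x₀).intervalIntegrable _ _) ?_ ?_ intervalIntegrable_const ?_).2
  · exact (hF'.comp (by fun_prop : Continuous fun t : ℝ => (x₀, t))).aestronglyMeasurable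
  · exact Filter.Eventually.of_forall fun t ht x hx =>
      hC (x, t) ⟨hx, Set.uIoc_subset_uIcc ht⟩
  · exact Filter.Eventually.of_forall fun t _ x _ => h x t

theorem cosh_sub_sinh_mul_cos_pos (x θ : ℝ) :
    0 < Real.cosh x - Real.sinh x * Real.cos θ :=
  cosh_sub_sinh_mul_pos x (Real.abs_cos_le_one θ)

theorem hasDerivAt_cosh_sub_sinh_mul (x c : ℝ) :
    HasDerivAt (fun y => Real.cosh y - Real.sinh y * c) (Real.sinh x - Real.cosh x * c) x :=
  (Real.hasDerivAt_cosh x).sub ((Real.hasDerivAt_sinh x).mul_const c)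

/-- The derivative of `legendreIntegral`. -/
noncomputable def legendreIntegralDeriv (k : ℕ) (α x : ℝ) : ℝ :=
  ∫ θ in (0 : ℝ)..Real.pi, -α * (Real.cosh x - Real.sinh x * Real.cos θ) ^ (-α - 1) *
    (Real.sinh x - Real.cosh x * Real.cos θ) * Real.sin θ ^ (k - 1)

theorem continuous_cosh_sub_sinh_mul_cos_rpow (β : ℝ) :
    Continuous fun p : ℝ × ℝ => (Real.cosh p.1 - Real.sinh p.1 * Real.cos p.2) ^ β :=
  Continuous.rpow_const (by fun_prop) fun p => Or.inl (cosh_sub_sinh_mul_cos_pos p.1 p.2).ne'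

theorem continuous_cosh_sub_sinh_mul_cos_rpow_right (β x : ℝ) :
    Continuous fun θ : ℝ => (Real.cosh x - Real.sinh x * Real.cos θ) ^ β :=
  (continuous_cosh_sub_sinh_mul_cos_rpow β).comp (by fun_prop : Continuous fun θ : ℝ => (x, θ))

theorem hasDerivAt_legendreIntegral (k : ℕ) (α x : ℝ) :
    HasDerivAt (legendreIntegral k α) (legendreIntegralDeriv k α x) x := by
  refine hasDerivAt_intervalIntegral_of_continuous
    (F := fun x θ => (Real.cosh x - Real.sinh x * Real.cos θ) ^ (-α) * Real.sin θ ^ (k - 1))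
    (F' := fun x θ => -α * (Real.cosh x - Real.sinh x * Real.cos θ) ^ (-α - 1) *
    (Real.sinh x - Real.cosh x * Real.cos θ) * Real.sin θ ^ (k - 1)) ?_ ?_ ?_ _ _ _
  · intro x
    have := continuous_cosh_sub_sinh_mul_cos_rpow_right (-α) x
    fun_prop
  · have := continuous_cosh_sub_sinh_mul_cos_rpow (-α - 1)
    simp only [Function.uncurry_def]
    fun_prop
  · intro x θ
    have h := ((hasDerivAt_cosh_sub_sinh_mul x (Real.cos θ)).rpow_const (p := -α)
      (Or.inl (cosh_sub_sinh_mul_cos_pos x θ).ne')).mul_const (Real.sin θ ^ (k - 1))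
    refine h.congr_deriv ?_
    ring

/-- Writing `D = cosh x - sinh x cos θ`, one has `D_xx = D` and `D_x² = D² - sin² θ`. The second
identity removes `D_x` from the second derivative of `D^(-α)`. -/
theorem hasDerivAt_legendreIntegralDeriv (k : ℕ) (α x : ℝ) :
    HasDerivAt (legendreIntegralDeriv k α) (∫ θ in (0 : ℝ)..Real.pi,
      (α ^ 2 * (Real.cosh x - Real.sinh x * Real.cos θ) ^ (-α)
        - α * (α + 1) * (Real.cosh x - Real.sinh x * Real.cos θ) ^ (-α - 2) * Real.sin θ ^ 2)
        * Real.sin θ ^ (k - 1)) x := by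
  refine hasDerivAt_intervalIntegral_of_continuous
    (F := fun x θ => -α * (Real.cosh x - Real.sinh x * Real.cos θ) ^ (-α - 1) *
      (Real.sinh x - Real.cosh x * Real.cos θ) * Real.sin θ ^ (k - 1))
    (F' := fun x θ => (α ^ 2 * (Real.cosh x - Real.sinh x * Real.cos θ) ^ (-α)
        - α * (α + 1) * (Real.cosh x - Real.sinh x * Real.cos θ) ^ (-α - 2) * Real.sin θ ^ 2)
        * Real.sin θ ^ (k - 1)) ?_ ?_ ?_ _ _ _
  · intro x
    have := continuous_cosh_sub_sinh_mul_cos_rpow_right (-α - 1) x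
    fun_prop
  · have := continuous_cosh_sub_sinh_mul_cos_rpow (-α)
    have := continuous_cosh_sub_sinh_mul_cos_rpow (-α - 2)
    simp only [Function.uncurry_def]
    fun_prop
  · intro x θ
    have hD := cosh_sub_sinh_mul_cos_pos x θ
    have h1 := ((hasDerivAt_cosh_sub_sinh_mul x (Real.cos θ)).rpow_const (p := -α - 1)
      (Or.inl hD.ne')).const_mul (-α)
    have h2 : HasDerivAt (fun y => Real.sinh y - Real.cosh y * Real.cos θ)
        (Real.cosh x - Real.sinh x * Real.cos θ) x :=
      (Real.hasDerivAt_sinh x).sub ((Real.hasDerivAt_cosh x).mul_const _)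
    have h := (h1.mul h2).mul_const (Real.sin θ ^ (k - 1))
    refine h.congr_deriv ?_
    have e1 : (Real.cosh x - Real.sinh x * Real.cos θ) ^ (-α) =
        (Real.cosh x - Real.sinh x * Real.cos θ) ^ (-α - 2) *
        (Real.cosh x - Real.sinh x * Real.cos θ) ^ 2 := by
      rw [← Real.rpow_natCast, ← Real.rpow_add hD]; congr 1; push_cast; ring
    have e2 : (Real.cosh x - Real.sinh x * Real.cos θ) ^ (-α - 1) =
        (Real.cosh x - Real.sinh x * Real.cos θ) ^ (-α - 2) *
        (Real.cosh x - Real.sinh x * Real.cos θ) := by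
      rw [← Real.rpow_add_one hD.ne']; congr 1; ring
    have e3 : (-α - 1 - 1 : ℝ) = -α - 2 := by ring
    rw [e1, e2, e3]
    have hs := Real.sin_sq_add_cos_sq θ
    have hc := Real.cosh_sq x
    have key : (Real.sinh x - Real.cosh x * Real.cos θ) ^ 2 =
        (Real.cosh x - Real.sinh x * Real.cos θ) ^ 2 - Real.sin θ ^ 2 := by
      linear_combination (Real.cos θ ^ 2 - 1) * hc + hs
    linear_combination (α * (α + 1) * (Real.cosh x - Real.sinh x * Real.cos θ) ^ (-α - 2) *
      Real.sin θ ^ (k - 1)) * key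

/-- The integrand is the `θ`-derivative of `D^β sin^k θ`, which vanishes at both endpoints because
`k ≥ 1`. -/
theorem integral_deriv_rpow_mul_sin_pow_eq_zero {k : ℕ} (hk : 1 ≤ k) (β x : ℝ) :
    ∫ θ in (0 : ℝ)..Real.pi,
      (β * (Real.cosh x - Real.sinh x * Real.cos θ) ^ (β - 1) * (Real.sinh x * Real.sin θ)
          * Real.sin θ ^ k
        + (Real.cosh x - Real.sinh x * Real.cos θ) ^ β *
          (k * Real.sin θ ^ (k - 1) * Real.cos θ)) = 0 := by
  have h := intervalIntegral.integral_eq_sub_of_hasDerivAt (a := 0) (b := Real.pi)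
    (f := fun θ => (Real.cosh x - Real.sinh x * Real.cos θ) ^ β * Real.sin θ ^ k)
    (f' := fun θ => (β * (Real.cosh x - Real.sinh x * Real.cos θ) ^ (β - 1) *
        (Real.sinh x * Real.sin θ) * Real.sin θ ^ k
        + (Real.cosh x - Real.sinh x * Real.cos θ) ^ β *
          (k * Real.sin θ ^ (k - 1) * Real.cos θ))) ?_ ?_
  · rw [h]
    simp [show k ≠ 0 by omega]
  · intro θ _
    have h1 : HasDerivAt (fun θ => Real.cosh x - Real.sinh x * Real.cos θ)
        (Real.sinh x * Real.sin θ) θ := by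
      have := ((Real.hasDerivAt_cos θ).const_mul (Real.sinh x)).const_sub (Real.cosh x)
      refine this.congr_deriv ?_
      ring
    have h2 := (h1.rpow_const (p := β) (Or.inl (cosh_sub_sinh_mul_cos_pos x θ).ne')).mul
      ((Real.hasDerivAt_sin θ).pow k)
    refine h2.congr_deriv ?_
    simp only [Pi.pow_apply]
    ring
  · apply Continuous.intervalIntegrable
    have := continuous_cosh_sub_sinh_mul_cos_rpow_right (β - 1) x
    have := continuous_cosh_sub_sinh_mul_cos_rpow_right β x
    fun_prop

/-- Under the integral sign, the left side is `α / sinh x` times the `θ`-derivative of `D^(-α-1)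
sin^k θ`, so it integrates to zero. -/
theorem legendreIntegral_ode {k : ℕ} (hk : 1 ≤ k) (α : ℝ) {x : ℝ} (hx : 0 < x) :
    (∫ θ in (0 : ℝ)..Real.pi,
      (α ^ 2 * (Real.cosh x - Real.sinh x * Real.cos θ) ^ (-α)
        - α * (α + 1) * (Real.cosh x - Real.sinh x * Real.cos θ) ^ (-α - 2) * Real.sin θ ^ 2)
        * Real.sin θ ^ (k - 1))
      + k * (Real.cosh x / Real.sinh x) * legendreIntegralDeriv k α x
      - α * (α - k) * legendreIntegral k α x = 0 := by
  have hsx : 0 < Real.sinh x := Real.sinh_pos_iff.2 hx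
  have h0 := integral_deriv_rpow_mul_sin_pow_eq_zero hk (-α - 1) x
  have c0 := continuous_cosh_sub_sinh_mul_cos_rpow_right (-α) x
  have c1 := continuous_cosh_sub_sinh_mul_cos_rpow_right (-α - 1) x
  have c2 := continuous_cosh_sub_sinh_mul_cos_rpow_right (-α - 2) x
  rw [legendreIntegralDeriv, legendreIntegral, ← intervalIntegral.integral_const_mul,
    ← intervalIntegral.integral_const_mul, ← intervalIntegral.integral_add,
    ← intervalIntegral.integral_sub]
  · have h0' := congrArg (fun z => α / Real.sinh x * z) h0
    simp only [mul_zero, ← intervalIntegral.integral_const_mul] at h0'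
    refine Eq.trans ?_ h0'
    refine intervalIntegral.integral_congr fun θ _ => ?_
    have hD := cosh_sub_sinh_mul_cos_pos x θ
    have e1 : (Real.cosh x - Real.sinh x * Real.cos θ) ^ (-α) =
        (Real.cosh x - Real.sinh x * Real.cos θ) ^ (-α - 2) *
        (Real.cosh x - Real.sinh x * Real.cos θ) ^ 2 := by
      rw [← Real.rpow_natCast, ← Real.rpow_add hD]; congr 1; push_cast; ring
    have e2 : (Real.cosh x - Real.sinh x * Real.cos θ) ^ (-α - 1) =
        (Real.cosh x - Real.sinh x * Real.cos θ) ^ (-α - 2) *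
        (Real.cosh x - Real.sinh x * Real.cos θ) := by
      rw [← Real.rpow_add_one hD.ne']; congr 1; ring
    have e3 : (-α - 1 - 1 : ℝ) = -α - 2 := by ring
    rw [e3, e1, e2]
    obtain ⟨n, rfl⟩ : ∃ n, k = n + 1 := ⟨k - 1, by omega⟩
    have hc := Real.cosh_sq x
    rw [Nat.add_sub_cancel]
    set P := (Real.cosh x - Real.sinh x * Real.cos θ) ^ (-α - 2)
    field_simp
    push_cast
    linear_combination (α * P * Real.sin θ ^ n * (n + 1) *
      (Real.cosh x - Real.sinh x * Real.cos θ) * Real.cos θ) * hc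
  all_goals
    apply Continuous.intervalIntegrable
    fun_prop

theorem legendreIntegral_pos (k : ℕ) (α x : ℝ) : 0 < legendreIntegral k α x := by
  have c0 := continuous_cosh_sub_sinh_mul_cos_rpow_right (-α) x
  refine intervalIntegral.intervalIntegral_pos_of_pos_on
    (Continuous.intervalIntegrable (by fun_prop) _ _) (fun θ hθ => ?_) Real.pi_pos
  have := Real.sin_pos_of_pos_of_lt_pi hθ.1 hθ.2
  have := Real.rpow_pos_of_pos (cosh_sub_sinh_mul_cos_pos x θ) (-α)
  positivity

/-- The normalized Legendre integral is a radial eigenfunction. -/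
theorem isRadialEigenfunction_legendreIntegral {k : ℕ} (hk : 1 ≤ k) {ρ : ℝ} (hρ : 0 < ρ)
    {α lam : ℝ} (hlam : lam * ρ ^ 2 = -(α * (α - k))) :
    IsRadialEigenfunction k ρ lam
      (fun r => legendreIntegral k α (r / ρ) / legendreIntegral k α 0) := by
  have hd1 : ∀ r, HasDerivAt (fun r => legendreIntegral k α (r / ρ) / legendreIntegral k α 0)
      (legendreIntegralDeriv k α (r / ρ) * (1 / ρ) / legendreIntegral k α 0) r := fun r =>
    ((hasDerivAt_legendreIntegral k α (r / ρ)).comp r ((hasDerivAt_id r).div_const ρ)).div_const _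
  have hd : deriv (fun r => legendreIntegral k α (r / ρ) / legendreIntegral k α 0) =
      fun r => legendreIntegralDeriv k α (r / ρ) * (1 / ρ) / legendreIntegral k α 0 :=
    funext fun r => (hd1 r).deriv
  have hd2 : ∀ r, HasDerivAt
      (fun r => legendreIntegralDeriv k α (r / ρ) * (1 / ρ) / legendreIntegral k α 0) _ r :=
    fun r => (((hasDerivAt_legendreIntegralDeriv k α (r / ρ)).comp r
    ((hasDerivAt_id r).div_const ρ)).mul_const (1 / ρ)).div_const (legendreIntegral k α 0)
  refine ⟨fun r _ => (hd1 r).continuousAt.continuousWithinAt, ?_,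
    fun r _ => (hd1 r).differentiableAt, fun r _ => ?_, fun r hr => ?_⟩
  · simp [(legendreIntegral_pos k α 0).ne']
  · rw [hd]
    exact (hd2 r).differentiableAt
  · have hode := legendreIntegral_ode hk α (div_pos hr hρ)
    rw [hd, (hd2 r).deriv]
    have hl : lam = -(α * (α - k)) / ρ ^ 2 := by field_simp; exact hlam
    have h0 := (legendreIntegral_pos k α 0).ne'
    set I := ∫ θ in (0 : ℝ)..Real.pi,
      (α ^ 2 * (Real.cosh (r / ρ) - Real.sinh (r / ρ) * Real.cos θ) ^ (-α)
        - α * (α + 1) * (Real.cosh (r / ρ) - Real.sinh (r / ρ) * Real.cos θ) ^ (-α - 2)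
          * Real.sin θ ^ 2) * Real.sin θ ^ (k - 1)
    rw [hl]
    linear_combination (1 / (ρ ^ 2 * legendreIntegral k α 0)) * hode

/-! ### Uniqueness of the radial eigenfunction -/

/-- A function with derivative at least `c / r` near `0` is unbounded below near `0`. -/
theorem not_continuousOn_of_div_le_deriv {q q' : ℝ → ℝ} {c : ℝ} (hc : 0 < c)
    (hq : ContinuousOn q (Set.Ici 0)) (hd : ∀ r, 0 < r → HasDerivAt q (q' r) r)
    (h : ∀ r, 0 < r → r < 1 → c / r ≤ q' r) : False := by
  have hd' : ∀ r, 0 < r → HasDerivAt (fun r => q r - c * Real.log r) (q' r - c * r⁻¹) r :=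
    fun r hr => (hd r hr).sub ((Real.hasDerivAt_log hr.ne').const_mul c)
  have hmono : MonotoneOn (fun r => q r - c * Real.log r) (Set.Ioc 0 1) := by
    refine monotoneOn_of_deriv_nonneg (convex_Ioc 0 1) ?_ ?_ ?_
    · intro r hr
      exact (hd' r hr.1).continuousAt.continuousWithinAt
    · intro r hr
      rw [interior_Ioc] at hr
      exact (hd' r hr.1).differentiableAt.differentiableWithinAt
    · intro r hr
      rw [interior_Ioc] at hr
      rw [(hd' r hr.1).deriv]
      have := h r hr.1 hr.2
      rw [div_eq_mul_inv] at this
      linarith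
  have hle : ∀ r ∈ Set.Ioc (0 : ℝ) 1, q r ≤ q 1 + c * Real.log r := by
    intro r hr
    have := hmono hr ⟨one_pos, le_rfl⟩ hr.2
    simp only [Real.log_one, mul_zero, sub_zero] at this
    linarith
  have hlim : Filter.Tendsto q (nhdsWithin 0 (Set.Ioi 0)) (nhds (q 0)) :=
    (hq 0 Set.self_mem_Ici).mono_left (nhdsWithin_mono _ Set.Ioi_subset_Ici_self)
  have hbot : Filter.Tendsto (fun r => q 1 + c * Real.log r) (nhdsWithin 0 (Set.Ioi 0))
      Filter.atBot :=
    Filter.tendsto_atBot_add_const_left _ _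
      (Real.tendsto_log_nhdsGT_zero.const_mul_atBot hc)
  have hbot' : Filter.Tendsto q (nhdsWithin 0 (Set.Ioi 0)) Filter.atBot := by
    refine Filter.tendsto_atBot_mono' _ ?_ hbot
    filter_upwards [Ioc_mem_nhdsGT (zero_lt_one' ℝ)] with r hr using hle r hr
  exact not_tendsto_nhds_of_tendsto_atBot hbot' _ hlim

/-- The weighted Wronskian `W = sinh^k(r/ρ)(ψ'φ - ψφ')` is constant, and `(ψ/φ)' = W/(sinh^k(r/ρ)
φ²)`. If `W ≠ 0`, then `ψ/φ` diverges at least logarithmically at `0`, against continuity. So `ψ/φ`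
is constant, with value `1` at `0`. Positivity of `φ` makes the quotient available on the whole
half-line, and nothing is needed about derivatives at `0`. -/
theorem IsRadialEigenfunction.eqOn {k : ℕ} (hk : 1 ≤ k) {ρ lam : ℝ} (hρ : 0 < ρ) {φ ψ : ℝ → ℝ}
    (hφ : IsRadialEigenfunction k ρ lam φ) (hψ : IsRadialEigenfunction k ρ lam ψ)
    (hpos : ∀ r, 0 ≤ r → 0 < φ r) : Set.EqOn ψ φ (Set.Ici 0) := by
  have hsinh : ∀ r, 0 < r → 0 < Real.sinh (r / ρ) := fun r hr =>
    Real.sinh_pos_iff.2 (div_pos hr hρ)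
  let W : ℝ → ℝ := fun r => Real.sinh (r / ρ) ^ k * (deriv ψ r * φ r - ψ r * deriv φ r)
  have hW : ∀ r, 0 < r → HasDerivAt W 0 r := by
    intro r hr
    have h1 : HasDerivAt (fun r => Real.sinh (r / ρ) ^ k)
        (k * Real.sinh (r / ρ) ^ (k - 1) * (Real.cosh (r / ρ) * (1 / ρ))) r := by
      have h0 : HasDerivAt (fun r => Real.sinh (r / ρ)) (Real.cosh (r / ρ) * (1 / ρ)) r :=
        ((hasDerivAt_id r).div_const ρ).sinh
      exact h0.fun_pow k
    have dφ := (hφ.differentiableAt r hr).hasDerivAt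
    have dψ := (hψ.differentiableAt r hr).hasDerivAt
    have ddφ := (hφ.differentiableAt_deriv r hr).hasDerivAt
    have ddψ := (hψ.differentiableAt_deriv r hr).hasDerivAt
    have h := h1.mul ((ddψ.mul dφ).sub (dψ.mul ddφ))
    refine h.congr_deriv ?_
    have o1 := hφ.ode r hr
    have o2 := hψ.ode r hr
    have hs := (hsinh r hr).ne'
    obtain ⟨n, rfl⟩ : ∃ n, k = n + 1 := ⟨k - 1, by omega⟩
    have e1 : deriv (deriv φ) r = -(((n + 1 : ℕ) : ℝ) / ρ * (Real.cosh (r / ρ) / Real.sinh (r / ρ))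
      * deriv φ r + lam * φ r) := by linarith
    have e2 : deriv (deriv ψ) r = -(((n + 1 : ℕ) : ℝ) / ρ * (Real.cosh (r / ρ) / Real.sinh (r / ρ))
      * deriv ψ r + lam * ψ r) := by linarith
    simp only [Pi.sub_apply, Pi.mul_apply]
    rw [e1, e2, Nat.add_sub_cancel, pow_succ]
    field_simp
    ring
  have hWc : ∀ r, 0 < r → W r = W 1 := by
    intro r hr
    exact isOpen_Ioi.is_const_of_deriv_eq_zero isPreconnected_Ioi
      (fun r hr => (hW r hr).differentiableAt.differentiableWithinAt)
      (fun r hr => (hW r hr).deriv) hr (zero_lt_one' ℝ)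
  let q : ℝ → ℝ := fun r => ψ r / φ r
  have hqc : ContinuousOn q (Set.Ici 0) :=
    hψ.continuousOn.div hφ.continuousOn fun r hr => (hpos r hr).ne'
  have hq : ∀ r, 0 < r → HasDerivAt q (W 1 / (Real.sinh (r / ρ) ^ k * φ r ^ 2)) r := by
    intro r hr
    have h := (hψ.differentiableAt r hr).hasDerivAt.div (hφ.differentiableAt r hr).hasDerivAt
      (hpos r hr.le).ne'
    refine h.congr_deriv ?_
    rw [← hWc r hr]
    have := (hsinh r hr).ne'
    have := (hpos r hr.le).ne'
    simp only [W]
    field_simp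
  -- A linear bound suffices for every `k ≥ 1`: the mean value theorem gives `sinh(r/ρ) ≤ cosh(1/ρ)
  -- r/ρ`, and `r^k ≤ r` on `(0, 1)`.
  obtain ⟨C, hC0, hC⟩ : ∃ C : ℝ, 0 < C ∧ ∀ r, 0 < r → r < 1 →
      Real.sinh (r / ρ) ^ k * φ r ^ 2 ≤ C * r := by
    obtain ⟨A, hA⟩ := (isCompact_Icc (a := (0 : ℝ)) (b := 1)).exists_bound_of_continuousOn
      (hφ.continuousOn.mono Set.Icc_subset_Ici_self)
    have hA0 : 0 < A := (norm_pos_iff.2 (hpos 0 le_rfl).ne').trans_le (hA 0 (by simp))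
    refine ⟨Real.cosh (1 / ρ) ^ k * (1 / ρ) ^ k * A ^ 2, by positivity, fun r hr hr1 => ?_⟩
    have hsl : Real.sinh (r / ρ) ≤ Real.cosh (1 / ρ) * (1 / ρ) * r := by
      have hrρ := div_pos hr hρ
      obtain ⟨c, hc, hc'⟩ := exists_hasDerivAt_eq_slope Real.sinh Real.cosh hrρ
        Real.continuous_sinh.continuousOn fun x _ => Real.hasDerivAt_sinh x
      rw [Real.sinh_zero, sub_zero, sub_zero, eq_div_iff hrρ.ne'] at hc'
      have hcr : Real.cosh c ≤ Real.cosh (1 / ρ) := by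
        rw [Real.cosh_le_cosh, abs_of_pos hc.1, abs_of_pos (by positivity)]
        exact hc.2.le.trans (by gcongr)
      rw [← hc']
      calc _ ≤ Real.cosh (1 / ρ) * (r / ρ) := by gcongr
        _ = _ := by ring
    have h1 : Real.sinh (r / ρ) ^ k ≤ Real.cosh (1 / ρ) ^ k * (1 / ρ) ^ k * r := by
      calc _ ≤ (Real.cosh (1 / ρ) * (1 / ρ) * r) ^ k := pow_le_pow_left₀ (hsinh r hr).le hsl k
        _ = Real.cosh (1 / ρ) ^ k * (1 / ρ) ^ k * r ^ k := by rw [mul_pow, mul_pow]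
        _ ≤ _ := by
          gcongr
          exact pow_le_of_le_one hr.le hr1.le (by omega)
    have h2 : φ r ^ 2 ≤ A ^ 2 := by
      have := hA r ⟨hr.le, hr1.le⟩
      rw [Real.norm_eq_abs] at this
      exact sq_le_sq' (by linarith [neg_abs_le (φ r)]) (le_of_abs_le this)
    calc _ ≤ (Real.cosh (1 / ρ) ^ k * (1 / ρ) ^ k * r) * A ^ 2 := by gcongr
      _ = _ := by ring
  have hden : ∀ r, 0 < r → 0 < Real.sinh (r / ρ) ^ k * φ r ^ 2 := fun r hr =>
    mul_pos (pow_pos (hsinh r hr) k) (pow_pos (hpos r hr.le) 2)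
  have hbd : ∀ w : ℝ, 0 < w → ∀ r, 0 < r → r < 1 →
      w / C / r ≤ w / (Real.sinh (r / ρ) ^ k * φ r ^ 2) := by
    intro w hw r hr hr1
    rw [div_div]
    exact div_le_div_of_nonneg_left hw.le (hden r hr) (hC r hr hr1)
  have hW0 : W 1 = 0 := by
    rcases lt_trichotomy (W 1) 0 with h | h | h
    · exfalso
      refine not_continuousOn_of_div_le_deriv (div_pos (neg_pos.2 h) hC0) hqc.neg
        (fun r hr => (hq r hr).neg) fun r hr hr1 => ?_
      rw [← neg_div]
      exact hbd _ (neg_pos.2 h) r hr hr1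
    · exact h
    · exact (not_continuousOn_of_div_le_deriv (div_pos h hC0) hqc hq (hbd _ h)).elim
  have hq0 : q 0 = 1 := by simp [q, hφ.map_zero, hψ.map_zero]
  intro r hr
  have hr : (0 : ℝ) ≤ r := hr
  have hqd : ∀ r, 0 < r → HasDerivAt q 0 r := fun r hr => by simpa [hW0] using hq r hr
  have hq1 : ∀ r, 0 < r → q r = q 1 := fun r hr =>
    isOpen_Ioi.is_const_of_deriv_eq_zero isPreconnected_Ioi
      (fun r hr => (hqd r hr).differentiableAt.differentiableWithinAt)
      (fun r hr => (hqd r hr).deriv) hr (zero_lt_one' ℝ)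
  have hlim : Filter.Tendsto q (nhdsWithin 0 (Set.Ioi 0)) (nhds (q 0)) :=
    (hqc 0 Set.self_mem_Ici).mono_left (nhdsWithin_mono _ Set.Ioi_subset_Ici_self)
  have hlim' : Filter.Tendsto q (nhdsWithin 0 (Set.Ioi 0)) (nhds (q 1)) :=
    tendsto_const_nhds.congr' <| by
      filter_upwards [self_mem_nhdsWithin] with r hr using (hq1 r hr).symm
  have h01 := tendsto_nhds_unique hlim hlim'
  have : q r = 1 := by
    rcases hr.eq_or_lt with rfl | h
    · exact hq0
    · rw [hq1 r h, ← h01, hq0]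
  exact (div_eq_one_iff_eq (hpos r hr).ne').1 this

/-! ### Laplace's method -/

open Filter Topology in
theorem tendsto_mul_sin_div (v : ℝ) :
    Tendsto (fun c : ℝ => c * Real.sin (v / c)) atTop (𝓝 v) := by
  have h : Tendsto (fun c : ℝ => v * Real.sinc (v / c)) atTop (𝓝 (v * Real.sinc 0)) :=
    (Real.continuous_sinc.continuousAt.tendsto.comp
      (tendsto_const_nhds.div_atTop tendsto_id)).const_mul v
  rw [Real.sinc_zero, mul_one] at h
  refine h.congr' ?_
  filter_upwards [eventually_gt_atTop 0] with c hc
  rcases eq_or_ne v 0 with rfl | hv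
  · simp
  · rw [Real.sinc_of_ne_zero (div_ne_zero hv hc.ne')]
    field_simp

open Filter Topology in
theorem tendsto_mul_one_sub_cos_div_sqrt (v : ℝ) :
    Tendsto (fun α : ℝ => α * (1 - Real.cos (v / √α))) atTop (𝓝 (v ^ 2 / 2)) := by
  have h := (((tendsto_mul_sin_div (v / 2)).comp Real.tendsto_sqrt_atTop).pow 2).const_mul 2
  rw [show 2 * (v / 2) ^ 2 = v ^ 2 / 2 by ring] at h
  refine h.congr' ?_
  filter_upwards [eventually_ge_atTop 0] with α hα
  have h1 : Real.cos (v / √α) = 1 - 2 * Real.sin (v / 2 / √α) ^ 2 := by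
    rw [show v / √α = 2 * (v / 2 / √α) by ring, Real.cos_two_mul, Real.cos_sq']
    ring
  rw [h1, Function.comp_apply, mul_pow, Real.sq_sqrt hα]
  ring

/-- This Gaussian bound on all of `[0, π]` supplies the dominating function. It combines `1 - cos θ
≥ 2θ²/π²` with `log(1+y) ≥ y/(1+y) ≥ y/(1+2a)` for `y = 2aθ²/π² ≤ 2a`. -/
theorem one_add_mul_one_sub_cos_rpow_neg_le {a α θ : ℝ} (ha : 0 < a) (hα : 0 ≤ α)
    (h0 : 0 ≤ θ) (hπ : θ ≤ Real.pi) :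
    (1 + a * (1 - Real.cos θ)) ^ (-α) ≤
      Real.exp (-(2 * a / Real.pi ^ 2 / (1 + 2 * a)) * (α * θ ^ 2)) := by
  have hpi := Real.pi_pos
  have hcos := Real.cos_le_one_sub_mul_cos_sq (x := θ) (by rwa [abs_of_nonneg h0])
  set y := 2 * a / Real.pi ^ 2 * θ ^ 2 with hy
  have hy0 : 0 ≤ y := by positivity
  have hy1 : y ≤ 2 * a := by
    rw [hy, div_mul_eq_mul_div, div_le_iff₀ (by positivity)]
    gcongr
  have hle : 1 + y ≤ 1 + a * (1 - Real.cos θ) := by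
    have : y = a * (2 / Real.pi ^ 2 * θ ^ 2) := by rw [hy]; ring
    rw [this]
    gcongr
    linarith
  calc (1 + a * (1 - Real.cos θ)) ^ (-α) ≤ (1 + y) ^ (-α) :=
        Real.rpow_le_rpow_of_nonpos (by linarith) hle (by linarith)
    _ = Real.exp (Real.log (1 + y) * (-α)) := Real.rpow_def_of_pos (by linarith) _
    _ ≤ _ := by
      rw [Real.exp_le_exp]
      have h1 := Real.one_sub_inv_le_log_of_pos (x := 1 + y) (by linarith)
      have h2 : 1 - (1 + y)⁻¹ = y / (1 + y) := by field_simp; ring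
      have h3 : y / (1 + 2 * a) ≤ y / (1 + y) := by gcongr
      have h4 : y / (1 + 2 * a) * α ≤ Real.log (1 + y) * α := by
        apply mul_le_mul_of_nonneg_right _ hα
        linarith
      have h5 : -(2 * a / Real.pi ^ 2 / (1 + 2 * a)) * (α * θ ^ 2) = -(y / (1 + 2 * a) * α) := by
        rw [hy]; ring
      rw [h5]
      linarith

open Filter Topology in
/-- Laplace's method for the integral `∫_0^π (1 + a (1 - cos θ))^(-α) (sin θ)^(k-1) dθ`. -/
theorem tendsto_rpow_mul_integral_one_add_mul_one_sub_cos {k : ℕ} (hk : 1 ≤ k) {a : ℝ}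
    (ha : 0 < a) :
    Tendsto (fun α : ℝ => α ^ ((k : ℝ) / 2) *
      ∫ θ in (0 : ℝ)..Real.pi, (1 + a * (1 - Real.cos θ)) ^ (-α) * Real.sin θ ^ (k - 1)) atTop
      (𝓝 ((2 / a) ^ ((k : ℝ) / 2) * (1 / 2) * Real.Gamma ((k : ℝ) / 2))) := by
  have hpi := Real.pi_pos
  have hbase : ∀ θ, 0 < 1 + a * (1 - Real.cos θ) := fun θ => by
    have := mul_nonneg ha.le (sub_nonneg.2 (Real.cos_le_one θ))
    linarith
  -- The integrand after `θ = v/√α`, extended by zero. Of the factor `α^(k/2) = √α^(k-1) · √α`, the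
  -- first part joins the sine power and the second is absorbed by the change of variable.
  let F : ℝ → ℝ → ℝ := fun α v => (Set.Ioc 0 (√α * Real.pi)).indicator (fun v =>
    (1 + a * (1 - Real.cos (v / √α))) ^ (-α) * (√α * Real.sin (v / √α)) ^ (k - 1)) v
  have hF : ∀ α, 0 < α → α ^ ((k : ℝ) / 2) *
      (∫ θ in (0 : ℝ)..Real.pi, (1 + a * (1 - Real.cos θ)) ^ (-α) * Real.sin θ ^ (k - 1)) =
      ∫ v in Set.Ioi (0 : ℝ), F α v := by
    intro α hα
    have hc : 0 < √α := Real.sqrt_pos.2 hα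
    have h1 : α ^ ((k : ℝ) / 2) = √α ^ (k - 1) * √α := by
      rw [← pow_succ, Nat.sub_add_cancel hk, Real.sqrt_eq_rpow, ← Real.rpow_natCast,
        ← Real.rpow_mul hα.le]
      congr 1; ring
    have h2 := intervalIntegral.integral_comp_div (a := 0) (b := √α * Real.pi)
      (fun θ => (1 + a * (1 - Real.cos θ)) ^ (-α) * Real.sin θ ^ (k - 1)) hc.ne'
    rw [zero_div, mul_div_cancel_left₀ _ hc.ne', smul_eq_mul] at h2
    rw [h1, mul_assoc, ← h2, ← intervalIntegral.integral_const_mul,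
      intervalIntegral.integral_of_le (by positivity), setIntegral_indicator measurableSet_Ioc,
      Set.inter_eq_right.2 Set.Ioc_subset_Ioi_self]
    refine integral_congr_ae (Eventually.of_forall fun v => ?_)
    simp only [mul_pow]
    ring
  have hlimval : ∫ v in Set.Ioi (0 : ℝ), v ^ ((k : ℝ) - 1) * Real.exp (-(a / 2) * v ^ (2 : ℝ)) =
      (2 / a) ^ ((k : ℝ) / 2) * (1 / 2) * Real.Gamma ((k : ℝ) / 2) := by
    have hk0 : (1 : ℝ) ≤ k := by exact_mod_cast hk
    rw [integral_rpow_mul_exp_neg_mul_rpow two_pos (by linarith) (by positivity), sub_add_cancel,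
      neg_div, Real.rpow_neg (by positivity), ← Real.inv_rpow (by positivity), inv_div]
  rw [← hlimval]
  refine Tendsto.congr' (f₁ := fun α => ∫ v in Set.Ioi (0 : ℝ), F α v) ?_ ?_
  · filter_upwards [eventually_gt_atTop 0] with α hα using (hF α hα).symm
  have hkr : ((k - 1 : ℕ) : ℝ) = (k : ℝ) - 1 := by push_cast [hk]; ring
  set b := 2 * a / Real.pi ^ 2 / (1 + 2 * a) with hb
  have hb0 : 0 < b := by positivity
  refine tendsto_integral_filter_of_dominated_convergence
    (fun v => v ^ ((k : ℝ) - 1) * Real.exp (-b * v ^ 2)) ?_ ?_ ?_ ?_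
  · refine Eventually.of_forall fun α => Measurable.aestronglyMeasurable ?_
    exact Measurable.indicator (by fun_prop) measurableSet_Ioc
  · filter_upwards [eventually_gt_atTop 0] with α hα
    have hc : 0 < √α := Real.sqrt_pos.2 hα
    filter_upwards [ae_restrict_mem measurableSet_Ioi] with v hv
    have hv : 0 < v := hv
    by_cases hvc : v ∈ Set.Ioc 0 (√α * Real.pi)
    · simp only [F, Set.indicator_of_mem hvc]
      have hθ0 : 0 < v / √α := by positivity
      have hθ1 : v / √α ≤ Real.pi := by rw [div_le_iff₀ hc, mul_comm]; exact hvc.2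
      have hsin := Real.sin_nonneg_of_nonneg_of_le_pi hθ0.le hθ1
      have hrp := Real.rpow_nonneg (hbase (v / √α)).le (-α)
      rw [Real.norm_of_nonneg (by positivity), mul_comm]
      have h1 := one_add_mul_one_sub_cos_rpow_neg_le ha hα.le hθ0.le hθ1
      rw [div_pow, Real.sq_sqrt hα.le, mul_div_cancel₀ _ hα.ne', ← hb] at h1
      have h2 : √α * Real.sin (v / √α) ≤ v := by
        have := mul_le_mul_of_nonneg_left (Real.sin_le hθ0.le) hc.le
        rwa [mul_div_cancel₀ _ hc.ne'] at this
      rw [← hkr, Real.rpow_natCast]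
      gcongr
    · simp only [F, Set.indicator_of_notMem hvc, norm_zero]
      positivity
  · exact integrableOn_rpow_mul_exp_neg_mul_sq hb0 (by
      have : (1 : ℝ) ≤ k := by exact_mod_cast hk
      linarith)
  · filter_upwards [ae_restrict_mem measurableSet_Ioi] with v hv
    have hv : 0 < v := hv
    have hlim : Tendsto (fun α : ℝ => (1 + a * (1 - Real.cos (v / √α))) ^ (-α) *
        (√α * Real.sin (v / √α)) ^ (k - 1)) atTop
        (𝓝 (v ^ ((k : ℝ) - 1) * Real.exp (-(a / 2) * v ^ (2 : ℝ)))) := by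
      rw [mul_comm, ← hkr, Real.rpow_natCast]
      refine Tendsto.mul ?_ (((tendsto_mul_sin_div v).comp Real.tendsto_sqrt_atTop).pow (k - 1))
      have h1 : Tendsto (fun α : ℝ => α * (a * (1 - Real.cos (v / √α)))) atTop
          (𝓝 (a * (v ^ 2 / 2))) :=
        ((tendsto_mul_one_sub_cos_div_sqrt v).const_mul a).congr fun α => by ring
      have h2 := (Real.tendsto_one_add_rpow_exp_of_tendsto h1).inv₀ (Real.exp_pos _).ne'
      rw [← Real.exp_neg] at h2
      rw [Real.rpow_two, show -(a / 2) * v ^ 2 = -(a * (v ^ 2 / 2)) by ring]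
      exact h2.congr fun α => (Real.rpow_neg (hbase _).le α).symm
    refine hlim.congr' ?_
    have : ∀ᶠ α : ℝ in atTop, v / Real.pi ≤ √α :=
      Real.tendsto_sqrt_atTop.eventually_ge_atTop _
    filter_upwards [this] with α hα
    have : v ∈ Set.Ioc 0 (√α * Real.pi) := ⟨hv, (div_le_iff₀ hpi).1 hα⟩
    simp only [F, Set.indicator_of_mem this]

open Filter Topology in
-- Factoring out the minimum gives `D = e^(-x)(1 + a(1 - cos θ))` with `a = e^x sinh x`. The surplus
-- `e^(xk/2)` from `α = k/2 + s` turns `(2/a)^(k/2)` into `(2/sinh x)^(k/2)`.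
theorem tendsto_rpow_mul_legendreIntegral {k : ℕ} (hk : 1 ≤ k) {x : ℝ} (hx : 0 < x) :
    Tendsto (fun s : ℝ => s ^ ((k : ℝ) / 2) * Real.exp (-(x * s)) *
      legendreIntegral k ((k : ℝ) / 2 + s) x) atTop
      (𝓝 ((2 / Real.sinh x) ^ ((k : ℝ) / 2) * (1 / 2) * Real.Gamma ((k : ℝ) / 2))) := by
  have hsx : 0 < Real.sinh x := Real.sinh_pos_iff.2 hx
  set a := Real.exp x * Real.sinh x with ha
  have ha0 : 0 < a := by positivity
  have hleg : ∀ α, legendreIntegral k α x = Real.exp (x * α) *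
      ∫ θ in (0 : ℝ)..Real.pi, (1 + a * (1 - Real.cos θ)) ^ (-α) * Real.sin θ ^ (k - 1) := by
    intro α
    rw [legendreIntegral, ← intervalIntegral.integral_const_mul]
    refine intervalIntegral.integral_congr fun θ _ => ?_
    have h1 : Real.cosh x - Real.sinh x * Real.cos θ =
        Real.exp (-x) * (1 + a * (1 - Real.cos θ)) := by
      have : Real.exp (-x) * Real.exp x = 1 := by rw [← Real.exp_add]; simp
      have h2 := Real.cosh_sub_sinh x
      rw [ha]
      linear_combination (-(Real.sinh x * (1 - Real.cos θ))) * this + h2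
    have h0 : 0 ≤ 1 + a * (1 - Real.cos θ) := by
      have := mul_nonneg ha0.le (sub_nonneg.2 (Real.cos_le_one θ))
      linarith
    simp only [h1]
    rw [Real.mul_rpow (Real.exp_pos _).le h0, ← Real.exp_mul, neg_mul_neg, mul_assoc]
  have hα : Tendsto (fun s : ℝ => (k : ℝ) / 2 + s) atTop atTop :=
    tendsto_atTop_add_const_left _ _ tendsto_id
  have h1 := (tendsto_rpow_mul_integral_one_add_mul_one_sub_cos hk ha0).comp hα
  -- The base is `s/α`, so this factor replaces `α^(k/2)` by `s^(k/2)`.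
  have h2 : Tendsto (fun s : ℝ => (1 - (k : ℝ) / 2 / ((k : ℝ) / 2 + s)) ^ ((k : ℝ) / 2)) atTop
      (𝓝 1) := by
    have : Tendsto (fun s : ℝ => 1 - (k : ℝ) / 2 / ((k : ℝ) / 2 + s)) atTop (𝓝 (1 - 0)) :=
      tendsto_const_nhds.sub (tendsto_const_nhds.div_atTop hα)
    rw [sub_zero] at this
    simpa using this.rpow_const (p := (k : ℝ) / 2) (Or.inl one_ne_zero)
  have h3 := (h2.mul h1).const_mul (Real.exp (x * (k / 2)))
  have hval : Real.exp (x * (k / 2)) * (1 * ((2 / a) ^ ((k : ℝ) / 2) * (1 / 2) *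
      Real.Gamma ((k : ℝ) / 2))) =
      (2 / Real.sinh x) ^ ((k : ℝ) / 2) * (1 / 2) * Real.Gamma ((k : ℝ) / 2) := by
    have : 2 / a = Real.exp (-x) * (2 / Real.sinh x) := by
      rw [ha, Real.exp_neg]; field_simp
    rw [this, Real.mul_rpow (Real.exp_pos _).le (by positivity), ← Real.exp_mul]
    have : Real.exp (x * (k / 2)) * Real.exp (-x * (k / 2)) = 1 := by rw [← Real.exp_add]; simp
    linear_combination ((2 / Real.sinh x) ^ ((k : ℝ) / 2) * (1 / 2) *
      Real.Gamma ((k : ℝ) / 2)) * this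
  rw [hval] at h3
  refine h3.congr' ?_
  filter_upwards [eventually_gt_atTop 0] with s hs
  have hks : 0 < (k : ℝ) / 2 + s := by positivity
  have e1 : s ^ ((k : ℝ) / 2) = (1 - (k : ℝ) / 2 / ((k : ℝ) / 2 + s)) ^ ((k : ℝ) / 2) *
      ((k : ℝ) / 2 + s) ^ ((k : ℝ) / 2) := by
    have h : 1 - (k : ℝ) / 2 / ((k : ℝ) / 2 + s) = s / ((k : ℝ) / 2 + s) := by
      field_simp; ring
    rw [h, ← Real.mul_rpow (by positivity) hks.le, div_mul_cancel₀ _ hks.ne']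
  have e2 : Real.exp (x * (k / 2 + s)) * Real.exp (-(x * s)) = Real.exp (x * (k / 2)) := by
    rw [← Real.exp_add]; congr 1; ring
  rw [hleg, e1, ← e2, Function.comp_apply]
  ring

/-! ### Normalizing constants and the symmetry in the exponent -/

theorem toSphere_real_univ_euclideanSpace {n : ℕ} (hn : 1 ≤ n) :
    (volume : Measure (EuclideanSpace ℝ (Fin n))).toSphere.real Set.univ =
      2 * Real.pi ^ ((n : ℝ) / 2) / Real.Gamma ((n : ℝ) / 2) := by
  have : Nonempty (Fin n) := ⟨⟨0, hn⟩⟩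
  have hn0 : (0 : ℝ) < n := by exact_mod_cast hn
  have hG : 0 < Real.Gamma ((n : ℝ) / 2) := Real.Gamma_pos_of_pos (by positivity)
  have hG' : Real.Gamma ((n : ℝ) / 2 + 1) = (n : ℝ) / 2 * Real.Gamma ((n : ℝ) / 2) :=
    Real.Gamma_add_one (by positivity)
  have hpi : √Real.pi ^ n = Real.pi ^ ((n : ℝ) / 2) := by
    rw [Real.sqrt_eq_rpow, ← Real.rpow_natCast, ← Real.rpow_mul Real.pi_pos.le]
    congr 1; ring
  rw [Measure.toSphere_real_apply_univ, Measure.real, EuclideanSpace.volume_ball,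
    ENNReal.ofReal_one, one_pow, one_mul, finrank_euclideanSpace, Fintype.card_fin,
    hG', hpi, ENNReal.toReal_ofReal (by positivity)]
  field_simp

theorem legendreIntegral_zero (k : ℕ) (α : ℝ) :
    legendreIntegral k α 0 = ∫ θ in (0 : ℝ)..Real.pi, Real.sin θ ^ (k - 1) := by
  simp [legendreIntegral]

/-- Slicing the constant function `1` gives `|S^k| = |S^(k-1)| ∫_0^π sin^(k-1) θ dθ`, and both areas
are known. -/
theorem integral_sin_pow_eq_Gamma {k : ℕ} (hk : 1 ≤ k) :
    ∫ θ in (0 : ℝ)..Real.pi, Real.sin θ ^ (k - 1) =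
      √Real.pi * Real.Gamma ((k : ℝ) / 2) / Real.Gamma (((k : ℝ) + 1) / 2) := by
  have hk0 : (0 : ℝ) < k := by exact_mod_cast hk
  have h := integral_toSphere_inner k hk (EuclideanSpace.single 0 1) (by simp) (f := fun _ => 1)
    measurable_const (fun _ _ => zero_le_one)
  simp only [integral_const, smul_eq_mul, mul_one, one_mul] at h
  rw [toSphere_real_univ_euclideanSpace hk, toSphere_real_univ_euclideanSpace (by omega)] at h
  have hG : 0 < Real.Gamma ((k : ℝ) / 2) := Real.Gamma_pos_of_pos (by positivity)
  have hG1 : 0 < Real.Gamma (((k : ℝ) + 1) / 2) := Real.Gamma_pos_of_pos (by positivity)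
  have hpi : Real.pi ^ (((k : ℝ) + 1) / 2) = Real.pi ^ ((k : ℝ) / 2) * √Real.pi := by
    rw [Real.sqrt_eq_rpow, ← Real.rpow_add Real.pi_pos]
    congr 1; ring
  have hp : 0 < Real.pi ^ ((k : ℝ) / 2) := Real.rpow_pos_of_pos Real.pi_pos _
  push_cast at h
  rw [hpi] at h
  field_simp at h ⊢
  linarith

/-- The Legendre integral is symmetric under `α ↦ k - α`. -/
theorem legendreIntegral_add_eq_sub {k : ℕ} (hk : 1 ≤ k) (s : ℝ) {x : ℝ} (hx : 0 ≤ x) :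
    legendreIntegral k ((k : ℝ) / 2 + s) x = legendreIntegral k ((k : ℝ) / 2 - s) x := by
  -- Both exponents give the eigenvalue `k²/4 - s²` for `ρ = 1`, and uniqueness holds whatever its
  -- sign. The normalizations agree since at `x = 0` the integrand does not depend on the exponent.
  have h1 := isRadialEigenfunction_legendreIntegral hk one_pos (α := (k : ℝ) / 2 + s)
    (lam := (k : ℝ) ^ 2 / 4 - s ^ 2) (by ring)
  have h2 := isRadialEigenfunction_legendreIntegral hk one_pos (α := (k : ℝ) / 2 - s)
    (lam := (k : ℝ) ^ 2 / 4 - s ^ 2) (by ring)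
  have h := h2.eqOn hk one_pos h1 (fun r _ => div_pos (legendreIntegral_pos _ _ _)
    (legendreIntegral_pos _ _ _)) hx
  simp only [div_one, legendreIntegral_zero] at h
  have h0 := (legendreIntegral_pos k 0 0).ne'
  rw [legendreIntegral_zero] at h0
  exact (div_left_inj' h0).1 h

/-! ### The two asymptotic formulas -/

open Filter Topology in
-- The area of `S^(k-1)` cancels `Γ(k/2)/2` up to `π^(k/2)`, so the constant is `(2πρ²/sinh
-- x)^(k/2)`, where `sinh x = 2ρη/(ρ² - η²)`.
theorem isEquivalent_sphereIntegral_atTop {k : ℕ} (hk : 1 ≤ k) {ρ η : ℝ}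
    {m : EuclideanSpace ℝ (Fin (k + 1))} (hm : ‖m‖ = η) (h0 : 0 < η) (h1 : η < ρ) :
    Asymptotics.IsEquivalent atTop (fun s : ℝ => sphereIntegral k ρ m ((k : ℝ) / 2 + s))
      (fun s : ℝ => (Real.pi * ρ * (ρ ^ 2 - η ^ 2) / (η * |s|)) ^ ((k : ℝ) / 2)
          * ((ρ + η) / (ρ - η)) ^ |s|) := by
  have hρ : 0 < ρ := h0.trans h1
  have hk0 : (0 : ℝ) < k := by exact_mod_cast hk
  have hpi := Real.pi_pos
  have h2 : 0 < ρ - η := by linarith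
  have h4 : 0 < ρ ^ 2 - η ^ 2 := by nlinarith
  have hq : 0 < (ρ + η) / (ρ - η) := by positivity
  have hs := (cosh_sinh_log_div h0 h1).2
  have hx : 0 < Real.log ((ρ + η) / (ρ - η)) :=
    Real.log_pos (by rw [lt_div_iff₀ h2]; linarith)
  have hexp : ∀ s, ((ρ + η) / (ρ - η)) ^ s = Real.exp (Real.log ((ρ + η) / (ρ - η)) * s) :=
    fun s => Real.rpow_def_of_pos hq s
  have hF := fun α => sphereIntegral_eq_legendreIntegral hk hm h0 h1 α
  set x := Real.log ((ρ + η) / (ρ - η))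
  set c := (Real.pi * ρ * (ρ ^ 2 - η ^ 2) / η) ^ ((k : ℝ) / 2) with hc
  have hc0 : 0 < c := Real.rpow_pos_of_pos (by positivity) _
  have hG : 0 < Real.Gamma ((k : ℝ) / 2) := Real.Gamma_pos_of_pos (by positivity)
  have hrhs : ∀ s : ℝ, 0 < s → (Real.pi * ρ * (ρ ^ 2 - η ^ 2) / (η * |s|)) ^ ((k : ℝ) / 2)
      * ((ρ + η) / (ρ - η)) ^ |s| = c / s ^ ((k : ℝ) / 2) * Real.exp (x * s) := by
    intro s hs
    rw [abs_of_pos hs, hexp, ← div_div, Real.div_rpow (by positivity) hs.le]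
  have hlim := ((tendsto_rpow_mul_legendreIntegral hk hx).const_mul
    ((volume : Measure (EuclideanSpace ℝ (Fin k))).toSphere.real Set.univ)).const_mul (ρ ^ k / c)
  have hval : ρ ^ k / c * ((volume : Measure (EuclideanSpace ℝ (Fin k))).toSphere.real Set.univ *
      ((2 / Real.sinh x) ^ ((k : ℝ) / 2) * (1 / 2) * Real.Gamma ((k : ℝ) / 2))) = 1 := by
    have hρk : ρ ^ k = (ρ ^ 2) ^ ((k : ℝ) / 2) := by
      rw [← Real.rpow_natCast, ← Real.rpow_natCast, ← Real.rpow_mul hρ.le]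
      congr 1; push_cast; ring
    have hcc : c = (ρ ^ 2) ^ ((k : ℝ) / 2) * Real.pi ^ ((k : ℝ) / 2) *
        (2 / Real.sinh x) ^ ((k : ℝ) / 2) := by
      have : 0 ≤ 2 / Real.sinh x := (div_pos two_pos (Real.sinh_pos_iff.2 hx)).le
      rw [← Real.mul_rpow (by positivity) hpi.le, ← Real.mul_rpow (by positivity) this, hc, hs]
      congr 1
      field_simp
    rw [toSphere_real_univ_euclideanSpace hk, hρk, div_mul_eq_mul_div, div_eq_one_iff_eq hc0.ne',
      hcc]
    field_simp
  rw [hval] at hlim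
  refine Asymptotics.isEquivalent_of_tendsto_one (hlim.congr' ?_)
  filter_upwards [eventually_gt_atTop 0] with s hs0
  have hsk : 0 < s ^ ((k : ℝ) / 2) := Real.rpow_pos_of_pos hs0 _
  rw [Pi.div_apply, hF, hrhs s hs0, Real.exp_neg]
  field_simp

open Filter Topology in
theorem isEquivalent_sphereIntegral_atBot {k : ℕ} (hk : 1 ≤ k) {ρ η : ℝ}
    {m : EuclideanSpace ℝ (Fin (k + 1))} (hm : ‖m‖ = η) (h0 : 0 < η) (h1 : η < ρ) :
    Asymptotics.IsEquivalent atBot (fun s : ℝ => sphereIntegral k ρ m ((k : ℝ) / 2 + s))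
      (fun s : ℝ => (Real.pi * ρ * (ρ ^ 2 - η ^ 2) / (η * |s|)) ^ ((k : ℝ) / 2)
          * ((ρ + η) / (ρ - η)) ^ |s|) := by
  have h := (isEquivalent_sphereIntegral_atTop hk hm h0 h1).comp_tendsto tendsto_neg_atBot_atTop
  have hx : 0 ≤ Real.log ((ρ + η) / (ρ - η)) :=
    Real.log_nonneg (by rw [le_div_iff₀ (by linarith)]; linarith)
  refine (h.congr_left ?_).congr_right ?_
  · refine Eventually.of_forall fun s => ?_
    simp only [Function.comp_apply]
    rw [sphereIntegral_eq_legendreIntegral hk hm h0 h1,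
      sphereIntegral_eq_legendreIntegral hk hm h0 h1, legendreIntegral_add_eq_sub hk _ hx,
      sub_neg_eq_add]
  · refine Eventually.of_forall fun s => ?_
    simp only [Function.comp_apply, abs_neg]

theorem isRadialEigenfunction_sqrt {k : ℕ} (hk : 1 ≤ k) {ρ : ℝ} (hρ : 0 < ρ) {lam : ℝ}
    (hlam : lam < 0) : IsRadialEigenfunction k ρ lam (fun r =>
      legendreIntegral k ((k : ℝ) / 2 + √((k : ℝ) ^ 2 / 4 - lam * ρ ^ 2)) (r / ρ) /
        legendreIntegral k ((k : ℝ) / 2 + √((k : ℝ) ^ 2 / 4 - lam * ρ ^ 2)) 0) := by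
  have hnn : 0 ≤ (k : ℝ) ^ 2 / 4 - lam * ρ ^ 2 := by
    have : 0 < -lam * ρ ^ 2 := mul_pos (neg_pos.2 hlam) (by positivity)
    have : 0 ≤ (k : ℝ) ^ 2 / 4 := by positivity
    linarith
  refine isRadialEigenfunction_legendreIntegral hk hρ ?_
  linear_combination Real.sq_sqrt hnn

open Filter Topology in
-- The square root appears in an exponent, so its difference from `ρt` must vanish; a ratio tending
-- to `1` would not suffice.
theorem tendsto_sqrt_add_sq_sub {A ρ : ℝ} (hA : 0 ≤ A) (hρ : 0 < ρ) :
    Tendsto (fun t : ℝ => √(A + (ρ * t) ^ 2) - ρ * t) atTop (𝓝 0) := by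
  have h1 : Tendsto (fun t : ℝ => A / (ρ * t)) atTop (𝓝 0) :=
    tendsto_const_nhds.div_atTop (tendsto_id.const_mul_atTop hρ)
  refine tendsto_of_tendsto_of_tendsto_of_le_of_le' tendsto_const_nhds h1 ?_ ?_
  · filter_upwards with t
    have : ρ * t ≤ √(A + (ρ * t) ^ 2) := Real.le_sqrt_of_sq_le (by linarith)
    linarith
  · filter_upwards [eventually_gt_atTop 0] with t ht
    rw [sub_le_iff_le_add]
    refine Real.sqrt_le_iff.2 ⟨by positivity, ?_⟩
    have h2 : A / (ρ * t) * (ρ * t) = A := div_mul_cancel₀ _ (by positivity)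
    nlinarith [sq_nonneg (A / (ρ * t))]

open Filter Topology in
theorem isEquivalent_radialEigenfunction {k : ℕ} (hk : 1 ≤ k) {ρ : ℝ} (hρ : 0 < ρ)
    {φ : ℝ → ℝ → ℝ} (hφ : ∀ᶠ lam in atBot, IsRadialEigenfunction k ρ lam (φ lam))
    {r : ℝ} (hr : 0 < r) :
    Asymptotics.IsEquivalent atBot (fun lam : ℝ => φ lam r)
      (fun lam : ℝ => (2 / ρ) ^ ((k : ℝ) / 2)
          * (Real.Gamma (((k : ℝ) + 1) / 2)
              / (2 * Real.sqrt Real.pi * Real.sinh (r / ρ) ^ ((k : ℝ) / 2)))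
          * (Real.exp (r * Real.sqrt (-lam)) / (-lam) ^ ((k : ℝ) / 4))) := by
  have hk0 : (0 : ℝ) < k := by exact_mod_cast hk
  have hpi := Real.sqrt_pos.2 Real.pi_pos
  have hx : 0 < r / ρ := div_pos hr hρ
  have hsx : 0 < Real.sinh (r / ρ) := Real.sinh_pos_iff.2 hx
  have hG : 0 < Real.Gamma ((k : ℝ) / 2) := Real.Gamma_pos_of_pos (by positivity)
  have hG1 : 0 < Real.Gamma (((k : ℝ) + 1) / 2) := Real.Gamma_pos_of_pos (by positivity)
  let S : ℝ → ℝ := fun t => √((k : ℝ) ^ 2 / 4 + (ρ * t) ^ 2)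
  have hdiff : Tendsto (fun t => S t - ρ * t) atTop (𝓝 0) :=
    tendsto_sqrt_add_sq_sub (by positivity) hρ
  have hρt : Tendsto (fun t => ρ * t) atTop atTop := tendsto_id.const_mul_atTop hρ
  have hS : Tendsto S atTop atTop := by
    refine tendsto_atTop_mono (fun t => ?_) hρt
    exact Real.le_sqrt_of_sq_le (by linarith [(by positivity : 0 ≤ (k : ℝ) ^ 2 / 4)])
  have hratio : Tendsto (fun t => (ρ * t / S t) ^ ((k : ℝ) / 2)) atTop (𝓝 1) := by
    have h1 : Tendsto (fun t => 1 - (S t - ρ * t) / S t) atTop (𝓝 (1 - 0)) :=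
      tendsto_const_nhds.sub (hdiff.div_atTop hS)
    have h2 := (h1.congr' (f₂ := fun t => ρ * t / S t) (by
      filter_upwards [hS.eventually_gt_atTop 0] with t ht
      field_simp
      ring)).rpow_const (p := (k : ℝ) / 2) (Or.inl (by norm_num))
    simpa using h2
  have hexp : Tendsto (fun t => Real.exp (r / ρ * (S t - ρ * t))) atTop (𝓝 1) := by
    have := (Real.continuous_exp.tendsto _).comp (hdiff.const_mul (r / ρ))
    simpa only [mul_zero, Real.exp_zero, Function.comp_def] using this
  -- With `t = √(-λ)`, the two extra factors replace `S t` by `ρt` in the power and in the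
  -- exponential. The constant, which includes the value of the Legendre integral at `0`, makes the
  -- limit equal to `1`.
  have hlim := ((((tendsto_rpow_mul_legendreIntegral hk hx).comp hS).mul hratio).mul hexp).const_mul
    (2 * √Real.pi * (Real.sinh (r / ρ) ^ ((k : ℝ) / 2)) / (2 ^ ((k : ℝ) / 2) *
      Real.Gamma (((k : ℝ) + 1) / 2) *
      (√Real.pi * Real.Gamma ((k : ℝ) / 2) / Real.Gamma (((k : ℝ) + 1) / 2))))
  have hsk : 0 < Real.sinh (r / ρ) ^ ((k : ℝ) / 2) := Real.rpow_pos_of_pos hsx _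
  have h2k : 0 < (2 : ℝ) ^ ((k : ℝ) / 2) := Real.rpow_pos_of_pos two_pos _
  rw [Real.div_rpow two_pos.le hsx.le] at hlim
  have hsqrt : Tendsto (fun lam : ℝ => √(-lam)) atBot atTop :=
    Real.tendsto_sqrt_atTop.comp tendsto_neg_atBot_atTop
  refine Asymptotics.isEquivalent_of_tendsto_one ?_
  have hone := hlim.comp hsqrt
  refine Tendsto.congr' ?_ (hone.trans_eq ?_)
  · filter_upwards [hφ, eventually_lt_atBot 0] with lam hl hneg
    have ht : 0 < √(-lam) := Real.sqrt_pos.2 (neg_pos.2 hneg)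
    have hlam : lam = -√(-lam) ^ 2 := by rw [Real.sq_sqrt (neg_pos.2 hneg).le]; ring
    have hval := (isRadialEigenfunction_sqrt hk hρ hneg).eqOn hk hρ hl
      (fun r _ => div_pos (legendreIntegral_pos _ _ _) (legendreIntegral_pos _ _ _)) hr.le
    have hSt : √((k : ℝ) ^ 2 / 4 - lam * ρ ^ 2) = S √(-lam) := by
      simp only [S]; congr 1; linear_combination (-ρ ^ 2) * hlam
    rw [hSt, legendreIntegral_zero, integral_sin_pow_eq_Gamma hk] at hval
    have hpow : (-lam) ^ ((k : ℝ) / 4) = √(-lam) ^ ((k : ℝ) / 2) := by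
      rw [Real.sqrt_eq_rpow, ← Real.rpow_mul (neg_pos.2 hneg).le]; congr 1; ring
    simp only [Pi.div_apply, Function.comp_apply]
    rw [hval, hpow]
    set t := √(-lam)
    have hSpos : 0 < S t := Real.sqrt_pos.2 (by positivity)
    have hρk : 0 < ρ ^ ((k : ℝ) / 2) := Real.rpow_pos_of_pos hρ _
    have htk : 0 < t ^ ((k : ℝ) / 2) := Real.rpow_pos_of_pos ht _
    have hSk : 0 < S t ^ ((k : ℝ) / 2) := Real.rpow_pos_of_pos hSpos _
    have he : Real.exp (r / ρ * (S t - ρ * t)) = Real.exp (r / ρ * S t) / Real.exp (r * t) := by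
      rw [← Real.exp_sub]; congr 1; field_simp
    rw [he, Real.exp_neg, Real.div_rpow (by positivity) hSpos.le, Real.mul_rpow hρ.le ht.le,
      Real.div_rpow two_pos.le hρ.le]
    field_simp
  · congr 1
    field_simp

theorem mainTheorem9 (k : ℕ) (hk : 1 ≤ k) (ρ : ℝ) (hρ : 0 < ρ) :
    -- first form: the asymptotics of `F(k/2 + s)` as `s → ±∞`, where `η = |m|`
    (∀ (m : EuclideanSpace ℝ (Fin (k + 1))) (η : ℝ), ‖m‖ = η → 0 < η → η < ρ →
      Asymptotics.IsEquivalent Filter.atTop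
        (fun s : ℝ => sphereIntegral k ρ m ((k : ℝ) / 2 + s))
        (fun s : ℝ => (Real.pi * ρ * (ρ ^ 2 - η ^ 2) / (η * |s|)) ^ ((k : ℝ) / 2)
          * ((ρ + η) / (ρ - η)) ^ |s|) ∧
      Asymptotics.IsEquivalent Filter.atBot
        (fun s : ℝ => sphereIntegral k ρ m ((k : ℝ) / 2 + s))
        (fun s : ℝ => (Real.pi * ρ * (ρ ^ 2 - η ^ 2) / (η * |s|)) ^ ((k : ℝ) / 2)
          * ((ρ + η) / (ρ - η)) ^ |s|)) ∧
    -- `φ_lam` is well defined for `lam < 0`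
    (∀ lam : ℝ, lam < 0 → ∃ φ : ℝ → ℝ, IsRadialEigenfunction k ρ lam φ ∧
      ∀ ψ : ℝ → ℝ, IsRadialEigenfunction k ρ lam ψ → Set.EqOn ψ φ (Set.Ici 0)) ∧
    -- second form: the asymptotics of `φ_lam(r)` as `lam → -∞` with `r` fixed
    (∀ φ : ℝ → ℝ → ℝ, (∀ᶠ lam in Filter.atBot, IsRadialEigenfunction k ρ lam (φ lam)) →
      ∀ r : ℝ, 0 < r →
      Asymptotics.IsEquivalent Filter.atBot
        (fun lam : ℝ => φ lam r)
        (fun lam : ℝ => (2 / ρ) ^ ((k : ℝ) / 2)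
          * (Real.Gamma (((k : ℝ) + 1) / 2)
              / (2 * Real.sqrt Real.pi * Real.sinh (r / ρ) ^ ((k : ℝ) / 2)))
          * (Real.exp (r * Real.sqrt (-lam)) / (-lam) ^ ((k : ℝ) / 4)))) := by
  refine ⟨fun m η hm h0 h1 => ⟨isEquivalent_sphereIntegral_atTop hk hm h0 h1,
    isEquivalent_sphereIntegral_atBot hk hm h0 h1⟩, fun lam hlam => ?_,
    fun φ hφ r hr => isEquivalent_radialEigenfunction hk hρ hφ hr⟩
  have h := isRadialEigenfunction_sqrt hk hρ hlam
  exact ⟨_, h, fun ψ hψ => h.eqOn hk hρ hψ fun r _ =>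
    div_pos (legendreIntegral_pos _ _ _) (legendreIntegral_pos _ _ _)⟩
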